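/- Let $L>0$, $\omega>0$, $\gamma>0$ and let $p\ge 2$ be an even integer. Let $H^1_{per,odd}([0,L])$ be the space of real, odd, $L$-periodic functions in $H^1_{per}([0,L])$, and put $$B_\omega(u)=\frac12\int_0^L\big(u'^2+\omega u^2\big)\,dx,\qquad Z_\gamma=\Big\{u\in H^1_{per,odd}([0,L]):\ \int_0^L u^{p+2}\,dx=\gamma\Big\}.$$ Let $\psi\in Z_\gamma$ be a minimizer of $B_\omega$ on $Z_\gamma$, that is, $B_\omega(\psi)=\inf_{u\in Z_\gamma}B_\omega(u)$. Then there is a constant $k>0$ such that $\phi=k\psi$ is (almost everywhere equal to) a smooth odd $L$-periodic function which solves $$-\phi''+\omega\phi-\phi^{p+1}=0\quad\text{on }\mathbb{R}.$$ Moreover, the linearized operator $\mathcal{L}=-\partial_x^2+\omega-(p+1)\phi^p$ on $L^2_{per}([0,L])$ with domain $H^2_{per}([0,L])$ satisfies $\ker(\mathcal{L})=[\phi']$, the linear span of $\phi'$, and $n(\mathcal{L})=2$: it has exactly two negative eigenvalues, both when eigenvalues are counted with multiplicity and when distinct eigenvalues are counted. -/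

import Mathlib

open MeasureTheory Set

noncomputable section

namespace OddWave

/-- The real Hilbert space `L²_per([0,L])`. -/
abbrev L2per (L : ℝ) : Type := Lp ℝ 2 (volume.restrict (Ioc (0 : ℝ) L))

/-- `v` is the weak derivative of `u` on the circle of length `L`: the test functions are the
smooth `L`-periodic functions, so that periodicity of `u` is part of the condition. -/
def IsWeakDeriv {L : ℝ} (u v : L2per L) : Prop :=
  ∀ η : ℝ → ℝ, ContDiff ℝ (⊤ : ℕ∞) η → Function.Periodic η L →
    ∫ x in Ioc 0 L, u x * deriv η x = - ∫ x in Ioc 0 L, v x * η x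

lemma integrable_mul_cont {L : ℝ} (u : L2per L) {g : ℝ → ℝ} (hg : Continuous g) :
    Integrable (fun x => u x * g x) (volume.restrict (Ioc (0 : ℝ) L)) := by
  have hu : Integrable (u : ℝ → ℝ) (volume.restrict (Ioc (0 : ℝ) L)) :=
    (Lp.memLp u).integrable (by norm_num)
  obtain ⟨M, hM⟩ := (isCompact_Icc (a := (0 : ℝ)) (b := L)).exists_bound_of_continuousOn
    hg.continuousOn
  refine hu.mul_bdd (c := M) hg.aestronglyMeasurable ?_
  filter_upwards [ae_restrict_mem measurableSet_Ioc] with x hx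
  exact hM x ⟨hx.1.le, hx.2⟩

lemma IsWeakDeriv.add {L : ℝ} {u v u' v' : L2per L} (h : IsWeakDeriv u v)
    (h' : IsWeakDeriv u' v') : IsWeakDeriv (u + u') (v + v') := by
  intro η hη hp
  have hd : Continuous (deriv η) := hη.continuous_deriv (by simp)
  have e1 : ∫ x in Ioc 0 L, (u + u' : L2per L) x * deriv η x
      = ∫ x in Ioc 0 L, (u x * deriv η x + u' x * deriv η x) := by
    refine integral_congr_ae ?_
    filter_upwards [Lp.coeFn_add u u'] with x hx
    simp only [hx, Pi.add_apply]; ring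
  have e2 : ∫ x in Ioc 0 L, (v + v' : L2per L) x * η x
      = ∫ x in Ioc 0 L, (v x * η x + v' x * η x) := by
    refine integral_congr_ae ?_
    filter_upwards [Lp.coeFn_add v v'] with x hx
    simp only [hx, Pi.add_apply]; ring
  rw [e1, e2, integral_add (integrable_mul_cont u hd) (integrable_mul_cont u' hd),
    integral_add (integrable_mul_cont v hη.continuous) (integrable_mul_cont v' hη.continuous),
    h η hη hp, h' η hη hp]
  ring

lemma IsWeakDeriv.smul {L : ℝ} {u v : L2per L} (c : ℝ) (h : IsWeakDeriv u v) :
    IsWeakDeriv (c • u) (c • v) := by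
  intro η hη hp
  have e1 : ∫ x in Ioc 0 L, (c • u : L2per L) x * deriv η x
      = ∫ x in Ioc 0 L, c * (u x * deriv η x) := by
    refine integral_congr_ae ?_
    filter_upwards [Lp.coeFn_smul c u] with x hx
    simp only [hx, Pi.smul_apply, smul_eq_mul]; ring
  have e2 : ∫ x in Ioc 0 L, (c • v : L2per L) x * η x
      = ∫ x in Ioc 0 L, c * (v x * η x) := by
    refine integral_congr_ae ?_
    filter_upwards [Lp.coeFn_smul c v] with x hx
    simp only [hx, Pi.smul_apply, smul_eq_mul]; ring
  rw [e1, e2, integral_const_mul, integral_const_mul, h η hη hp]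
  ring

lemma isWeakDeriv_zero {L : ℝ} : IsWeakDeriv (0 : L2per L) 0 := by
  have key : ∀ g : ℝ → ℝ, ∫ x in Ioc 0 L, (0 : L2per L) x * g x = 0 := by
    intro g
    rw [integral_eq_zero_of_ae]
    filter_upwards [Lp.coeFn_zero ℝ 2 (volume.restrict (Ioc (0 : ℝ) L))] with x hx
    rw [hx]; simp
  intro η _ _
  rw [key, key, neg_zero]

/-- `u ∈ H¹_per([0,L])`. -/
def MemH1per {L : ℝ} (u : L2per L) : Prop := ∃ v : L2per L, IsWeakDeriv u v

open Classical in
/-- The weak derivative of `u ∈ H¹_per([0,L])` (and `0` outside that space). The smooth periodic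
functions are dense in `L²`, so the weak derivative is unique where it exists. -/
def weakDeriv {L : ℝ} (u : L2per L) : L2per L :=
  if h : MemH1per u then h.choose else 0

/-- Oddness of the `L`-periodic function with class `u`: since `u(-x) = u(L - x)`, it reads
`u(L - x) = -u(x)` for almost every `x ∈ (0,L]`. -/
def IsOddPer {L : ℝ} (u : L2per L) : Prop :=
  ∀ᵐ x ∂(volume.restrict (Ioc (0 : ℝ) L)), u (L - x) = - u x

/-- The constraint set `Z_γ = {u ∈ H¹_per,odd([0,L]) : ∫₀ᴸ u^(p+2) dx = γ}`. -/
def Z (L : ℝ) (p : ℕ) (γ : ℝ) : Set (L2per L) :=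
  {u | MemH1per u ∧ IsOddPer u ∧ ∫ x in Ioc 0 L, (u x) ^ (p + 2) = γ}

/-- The functional `B_ω(u) = ½ ∫₀ᴸ (u'² + ω u²) dx`. -/
def B (L ω : ℝ) (u : L2per L) : ℝ :=
  (1 / 2) * ∫ x in Ioc 0 L, ((weakDeriv u x) ^ 2 + ω * (u x) ^ 2)

/-- The linearized operator `𝓛 = -∂ₓ² + ω - (p+1) φ^p` on `L²_per([0,L])` with domain
`H²_per([0,L])`, given by its graph: `u` lies in `H²_per([0,L])` and `𝓛 u = f`. -/
def LinOp (L ω : ℝ) (p : ℕ) (φ : ℝ → ℝ) (u f : L2per L) : Prop :=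
  ∃ u₁ u₂ : L2per L, IsWeakDeriv u u₁ ∧ IsWeakDeriv u₁ u₂ ∧
    ∀ᵐ x ∂(volume.restrict (Ioc (0 : ℝ) L)),
      f x = - u₂ x + ω * u x - (p + 1) * (φ x) ^ p * u x

/-- The space `{u ∈ H²_per([0,L]) : 𝓛 u = μ u}`. -/
def eigenspace (L ω : ℝ) (p : ℕ) (φ : ℝ → ℝ) (μ : ℝ) : Submodule ℝ (L2per L) where
  carrier := {u | LinOp L ω p φ u (μ • u)}
  zero_mem' := by
    refine ⟨0, 0, isWeakDeriv_zero, isWeakDeriv_zero, ?_⟩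
    · rw [smul_zero]
      filter_upwards [Lp.coeFn_zero ℝ 2 (volume.restrict (Ioc (0 : ℝ) L))] with x hx
      rw [hx]; simp
  add_mem' := by
    rintro u v ⟨u₁, u₂, h1, h2, h3⟩ ⟨v₁, v₂, k1, k2, k3⟩
    refine ⟨u₁ + v₁, u₂ + v₂, h1.add k1, h2.add k2, ?_⟩
    filter_upwards [h3, k3, Lp.coeFn_smul μ u, Lp.coeFn_smul μ v, Lp.coeFn_smul μ (u + v),
      Lp.coeFn_add u v, Lp.coeFn_add u₂ v₂] with x a1 a2 a3 a4 a5 a6 a7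
    simp only [Pi.smul_apply, smul_eq_mul, Pi.add_apply] at a3 a4 a5 a6 a7
    rw [a3] at a1
    rw [a4] at a2
    rw [a5, a6, a7]
    linear_combination a1 + a2
  smul_mem' := by
    rintro c u ⟨u₁, u₂, h1, h2, h3⟩
    refine ⟨c • u₁, c • u₂, h1.smul c, h2.smul c, ?_⟩
    filter_upwards [h3, Lp.coeFn_smul μ u, Lp.coeFn_smul μ (c • u),
      Lp.coeFn_smul c u, Lp.coeFn_smul c u₂] with x a1 a3 a5 a6 a7
    simp only [Pi.smul_apply, smul_eq_mul] at a3 a5 a6 a7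
    rw [a3] at a1
    rw [a5, a6, a7]
    linear_combination c * a1

/-- `ker 𝓛`. -/
def kerL (L ω : ℝ) (p : ℕ) (φ : ℝ → ℝ) : Submodule ℝ (L2per L) := eigenspace L ω p φ 0

/-- The set of negative eigenvalues of `𝓛`. -/
def negEigenvalues (L ω : ℝ) (p : ℕ) (φ : ℝ → ℝ) : Set ℝ :=
  {μ | μ < 0 ∧ eigenspace L ω p φ μ ≠ ⊥}

/-- The negative subspace of `𝓛`: the span of all eigenfunctions with negative eigenvalue. Its
dimension is the number `n(𝓛)` of negative eigenvalues counted with multiplicity. -/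
def negSubspace (L ω : ℝ) (p : ℕ) (φ : ℝ → ℝ) : Submodule ℝ (L2per L) :=
  ⨆ μ ∈ negEigenvalues L ω p φ, eigenspace L ω p φ μ

end OddWave

end

/-! Variational half. Minimality only gives criticality against odd variations, but the equation is
odd, so even test functions contribute nothing and the minimizer is a classical solution of `Ψ'' = ω
Ψ - c Ψ^(p+1)` with `c = 2 B(ψ) / γ > 0` (`exists_profile`). Multiplication by `k = c^(1/p)`
normalizes `c` to `1`. Minimality is used once more, to exclude zeros in `(0, L/2)`
(`minimizer_ne_zero`): changing the sign between a zero `a` and `L - a` preserves oddness, the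
constraint and the energy, so it yields another minimizer, hence another solution, which agrees with
`Ψ` near `0` but not in the middle. This contradicts uniqueness for the differential equation.
Uniqueness and conservation of energy then make `φ` symmetric about `L/4`, and the zeros of `φ'` are
exactly `±L/4` modulo `L`.

Spectral half. Since `φ'` solves `𝓛 φ' = 0` and has two zeros per period, Jacobi's inequality on its
two nodal intervals shows that the quadratic form of `𝓛` is nonnegative on periodic functions
vanishing at `±L/4` (`quadratic_nonneg`). These are two linear conditions, so at most two negative
directions exist. Two are found by shooting from `L/4` with data `(1, 0)`: between very negative `μ`
and `μ = 0` both the value and the slope at `0` change sign (`neg_pos_of_critical`). Vanishing slope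
gives an even periodic eigenfunction `u₀`, vanishing value an odd one `u₁`
(`exists_negative_eigenpairs`).

An eigenfunction `u` orthogonal to both is corrected by a combination of `u₀` and `u₁` so as to
vanish at `±L/4`; nonnegativity of the form then reads as `spectral_inequality`. For a negative
eigenvalue it forces `u = 0`, which gives exactly two simple negative eigenvalues. For eigenvalue
zero it forces `u (L/4) = 0`, so `u` is a multiple of `φ'`. -/

noncomputable section
namespace OddWave

open scoped Topology Interval

/-! ### Linear differential equations with a parameter: the Picard series. -/

section LinearODE

open scoped Nat

variable {E : Type*} [NormedAddCommGroup E] [NormedSpace ℝ E]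

/-- The terms of the Picard series of the linear equation `y' = A m y`, `y(0) = y₀`. -/
def picardTerm (A : ℝ → ℝ → E →L[ℝ] E) (y₀ : E) : ℕ → ℝ → ℝ → E
  | 0 => fun _ _ => y₀
  | n + 1 => fun m x => ∫ t in (0 : ℝ)..x, A m t (picardTerm A y₀ n m t)

lemma continuous_picardTerm {A : ℝ → ℝ → E →L[ℝ] E}
    (hA : Continuous (Function.uncurry A)) (y₀ : E) (n : ℕ) :
    Continuous (Function.uncurry (picardTerm A y₀ n)) := by
  induction n with
  | zero => exact continuous_const
  | succ n ih =>
    have h1 : Continuous fun z : (ℝ × ℝ) × ℝ =>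
        A z.1.1 z.2 (picardTerm A y₀ n z.1.1 z.2) := by
      have hp : Continuous fun z : (ℝ × ℝ) × ℝ => (z.1.1, z.2) := by fun_prop
      exact (hA.comp hp).clm_apply (ih.comp hp)
    exact intervalIntegral.continuous_parametric_intervalIntegral_of_continuous
      (f := fun z : ℝ × ℝ => fun t => A z.1 t (picardTerm A y₀ n z.1 t)) h1 continuous_snd

/-- Each integration gains a factor `C * |x| / (n + 1)`, so the Picard series is dominated by an
exponential series, locally uniformly in `x` and in the parameter. -/
lemma norm_picardTerm_le {A : ℝ → ℝ → E →L[ℝ] E}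
    (hA : Continuous (Function.uncurry A)) (y₀ : E) {m R C : ℝ} (hC0 : 0 ≤ C)
    (hC : ∀ t, |t| ≤ R → ‖A m t‖ ≤ C) (n : ℕ) :
    ∀ x, |x| ≤ R → ‖picardTerm A y₀ n m x‖ ≤ ‖y₀‖ * ((C * |x|) ^ n / n !) := by
  induction n with
  | zero => intro x _; simp [picardTerm]
  | succ n ih =>
    intro x hx
    have hmem : ∀ t ∈ Ι (0 : ℝ) x, |t| ≤ |x| := by
      intro t ht
      rcases le_total 0 x with h | h
      · rw [uIoc_of_le h] at ht
        rw [abs_of_pos ht.1, abs_of_nonneg h]; exact ht.2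
      · rw [uIoc_of_ge h] at ht
        rw [abs_of_nonpos ht.2, abs_of_nonpos h]; linarith [ht.1]
    calc ‖picardTerm A y₀ (n + 1) m x‖
        ≤ ∫ t in Ι (0 : ℝ) x, ‖A m t (picardTerm A y₀ n m t)‖ :=
          intervalIntegral.norm_integral_le_integral_norm_uIoc
      _ ≤ ∫ t in Ι (0 : ℝ) x, ‖y₀‖ * C ^ (n + 1) / n ! * |t - 0| ^ n := by
          refine setIntegral_mono_on ?_ ?_ measurableSet_uIoc ?_
          · have hc : Continuous fun t => ‖A m t (picardTerm A y₀ n m t)‖ := by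
              have hp : Continuous fun t : ℝ => (m, t) := by fun_prop
              exact ((hA.comp hp).clm_apply ((continuous_picardTerm hA y₀ n).comp hp)).norm
            exact (hc.intervalIntegrable 0 x).def'
          · have hc : Continuous fun t : ℝ => ‖y₀‖ * C ^ (n + 1) / n ! * |t - 0| ^ n := by
              fun_prop
            exact (hc.intervalIntegrable 0 x).def'
          · intro t ht
            have h1 := ih t ((hmem t ht).trans hx)
            calc ‖A m t (picardTerm A y₀ n m t)‖
                ≤ ‖A m t‖ * ‖picardTerm A y₀ n m t‖ := (A m t).le_opNorm _
              _ ≤ C * (‖y₀‖ * ((C * |t|) ^ n / n !)) := by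
                  gcongr
                  exact hC t ((hmem t ht).trans hx)
              _ = ‖y₀‖ * C ^ (n + 1) / n ! * |t - 0| ^ n := by
                  rw [sub_zero, mul_pow]; ring
      _ = ‖y₀‖ * ((C * |x|) ^ (n + 1) / (n + 1)!) := by
          rw [integral_const_mul, integral_pow_abs_sub_uIoc, sub_zero, Nat.factorial_succ]
          push_cast
          field_simp
          ring

/-- Solutions of a linear differential equation exist globally and depend continuously on a
parameter. -/
theorem exists_linear_ode_family [CompleteSpace E] {A : ℝ → ℝ → E →L[ℝ] E}
    (hA : Continuous (Function.uncurry A)) (y₀ : E) :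
    ∃ y : ℝ → ℝ → E, (∀ m, y m 0 = y₀) ∧ (∀ m x, HasDerivAt (y m) (A m x (y m x)) x) ∧
      ∀ x, Continuous fun m => y m x := by
  have hbd : ∀ M R : ℝ, ∃ C, 0 ≤ C ∧ ∀ m, |m| ≤ M → ∀ t, |t| ≤ R → ‖A m t‖ ≤ C := by
    intro M R
    obtain ⟨C, hC⟩ := ((isCompact_Icc (a := -M) (b := M)).prod
      (isCompact_Icc (a := -R) (b := R))).exists_bound_of_continuousOn hA.continuousOn
    exact ⟨max C 0, le_max_right _ _, fun m hm t ht =>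
      (hC (m, t) ⟨abs_le.1 hm, abs_le.1 ht⟩).trans (le_max_left _ _)⟩
  have hder : ∀ n m x, HasDerivAt (picardTerm A y₀ (n + 1) m)
      (A m x (picardTerm A y₀ n m x)) x := by
    intro n m x
    have hc : Continuous fun t => A m t (picardTerm A y₀ n m t) := by
      have hp : Continuous fun t : ℝ => (m, t) := by fun_prop
      exact (hA.comp hp).clm_apply ((continuous_picardTerm hA y₀ n).comp hp)
    exact hc.integral_hasStrictDerivAt 0 x |>.hasDerivAt
  have hsum : ∀ m x, Summable fun n => picardTerm A y₀ n m x := by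
    intro m x
    obtain ⟨C, hC0, hC⟩ := hbd |m| |x|
    exact .of_norm_bounded ((Real.summable_pow_div_factorial (C * |x|)).mul_left ‖y₀‖)
      (fun n => norm_picardTerm_le hA y₀ hC0 (hC m le_rfl) n x le_rfl)
  refine ⟨fun m x => ∑' n, picardTerm A y₀ n m x, fun m => ?_, fun m x => ?_, fun x => ?_⟩
  · beta_reduce
    rw [(hsum m 0).tsum_eq_zero_add]
    simp [picardTerm]
  -- Termwise differentiation on a bounded interval containing both `x` and `0`. The derivative of
  -- term `n + 1` is `A` applied to term `n`, so the constant term is split off first.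
  · obtain ⟨C, hC0, hC⟩ := hbd |m| (|x| + 1)
    have key : HasDerivAt (fun z => ∑' n, picardTerm A y₀ (n + 1) m z)
        (∑' n, A m x (picardTerm A y₀ n m x)) x := by
      refine hasDerivAt_tsum_of_isPreconnected (t := Ioo (-(|x| + 1)) (|x| + 1)) (y₀ := 0)
        (u := fun n => C * (‖y₀‖ * ((C * (|x| + 1)) ^ n / n !)))
        (((Real.summable_pow_div_factorial _).mul_left _).mul_left _) isOpen_Ioo
        isPreconnected_Ioo (fun n z _ => hder n m z) (fun n z hz => ?_)
        ⟨by linarith [abs_nonneg x], by linarith [abs_nonneg x]⟩ ?_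
        (abs_lt.1 (lt_add_one |x|))
      · have hz' : |z| ≤ |x| + 1 := (abs_lt.2 hz).le
        calc ‖A m z (picardTerm A y₀ n m z)‖
            ≤ ‖A m z‖ * ‖picardTerm A y₀ n m z‖ := (A m z).le_opNorm _
          _ ≤ C * (‖y₀‖ * ((C * |z|) ^ n / n !)) := by
              gcongr
              · exact hC m le_rfl z hz'
              · exact norm_picardTerm_le hA y₀ hC0 (hC m le_rfl) n z hz'
          _ ≤ C * (‖y₀‖ * ((C * (|x| + 1)) ^ n / n !)) := by gcongr
      · exact (summable_nat_add_iff 1).2 (hsum m 0)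
    have e1 : (fun z => ∑' n, picardTerm A y₀ n m z) =
        fun z => y₀ + ∑' n, picardTerm A y₀ (n + 1) m z := by
      funext z
      rw [(hsum m z).tsum_eq_zero_add]; rfl
    beta_reduce
    rw [e1, (A m x).map_tsum (hsum m x)]
    exact key.const_add y₀
  · refine continuous_iff_continuousAt.2 fun m => ?_
    obtain ⟨C, hC0, hC⟩ := hbd (|m| + 1) |x|
    have hco : ContinuousOn (fun m => ∑' n, picardTerm A y₀ n m x)
        (Ioo (-(|m| + 1)) (|m| + 1)) := by
      refine continuousOn_tsum (u := fun n => ‖y₀‖ * ((C * |x|) ^ n / n !)) (fun n => ?_)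
        ((Real.summable_pow_div_factorial _).mul_left _) (fun n k hk => ?_)
      · have hp : Continuous fun m : ℝ => (m, x) := by fun_prop
        exact ((continuous_picardTerm hA y₀ n).comp hp).continuousOn
      · exact norm_picardTerm_le hA y₀ hC0 (hC k (abs_lt.2 hk).le) n x le_rfl
    exact hco.continuousAt (isOpen_Ioo.mem_nhds (abs_lt.1 (lt_add_one |m|)))

end LinearODE

/-! ### Hill's equation: uniqueness, Wronskians, shooting family, Jacobi's inequality. -/

/-- `u` solves Hill's equation `u'' = q u`, and `w = u'`. -/
def SolvesHill (q u w : ℝ → ℝ) : Prop :=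
  (∀ x, HasDerivAt u (w x) x) ∧ ∀ x, HasDerivAt w (q x * u x) x

namespace SolvesHill

variable {q u w u' w' : ℝ → ℝ}

lemma continuous_left (h : SolvesHill q u w) : Continuous u :=
  continuous_iff_continuousAt.2 fun x => (h.1 x).continuousAt

lemma continuous_right (h : SolvesHill q u w) : Continuous w :=
  continuous_iff_continuousAt.2 fun x => (h.2 x).continuousAt

lemma sub (h : SolvesHill q u w) (h' : SolvesHill q u' w') :
    SolvesHill q (fun x => u x - u' x) (fun x => w x - w' x) :=
  ⟨fun x => (h.1 x).sub (h'.1 x), fun x => ((h.2 x).sub (h'.2 x)).congr_deriv (by ring)⟩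

lemma const_mul (c : ℝ) (h : SolvesHill q u w) :
    SolvesHill q (fun x => c * u x) (fun x => c * w x) :=
  ⟨fun x => (h.1 x).const_mul c, fun x => ((h.2 x).const_mul c).congr_deriv (by ring)⟩

/-- Together with uniqueness, this passes a symmetry of the potential on to solutions with symmetric
or antisymmetric Cauchy data at the centre. -/
lemma reflect (h : SolvesHill q u w) {b : ℝ} (hq : ∀ x, q (b - x) = q x) :
    SolvesHill q (fun x => u (b - x)) (fun x => - w (b - x)) := by
  have hb : ∀ x, HasDerivAt (fun x : ℝ => b - x) (-1) x := fun x => by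
    simpa using (hasDerivAt_id x).const_sub b
  refine ⟨fun x => ((h.1 (b - x)).comp x (hb x)).congr_deriv (by ring), fun x => ?_⟩
  refine (((h.2 (b - x)).comp x (hb x)).neg).congr_deriv ?_
  rw [hq x]; ring

/-- A solution of Hill's equation with vanishing Cauchy data is zero. -/
theorem eq_zero (h : SolvesHill q u w) {C x₀ : ℝ} (hq : ∀ x, |q x| ≤ C)
    (hu : u x₀ = 0) (hw : w x₀ = 0) (x : ℝ) : u x = 0 ∧ w x = 0 := by
  have hC : 0 ≤ C := (abs_nonneg _).trans (hq 0)
  have key : (fun x => (u x, w x)) = fun _ => ((0 : ℝ), (0 : ℝ)) := by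
    refine ODE_solution_unique_univ (v := fun t y => (y.2, q t * y.1)) (s := fun _ => univ)
      (K := Real.toNNReal (max 1 C)) (t₀ := x₀) ?_ ?_ ?_ ?_
    · intro t
      refine (LipschitzWith.of_dist_le_mul fun y z => ?_).lipschitzOnWith
      rw [Real.coe_toNNReal _ (le_max_of_le_left zero_le_one), Prod.dist_eq, Prod.dist_eq]
      simp only [Real.dist_eq]
      refine max_le ?_ ?_
      · calc |y.2 - z.2| = 1 * |y.2 - z.2| := (one_mul _).symm
          _ ≤ _ := mul_le_mul (le_max_left _ _) (le_max_right _ _) (abs_nonneg _) (by positivity)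
      · rw [← mul_sub, abs_mul]
        exact mul_le_mul ((hq t).trans (le_max_right _ _)) (le_max_left _ _) (abs_nonneg _)
          (by positivity)
    · exact fun t => ⟨(h.1 t).prodMk (h.2 t), mem_univ _⟩
    · refine fun t => ⟨?_, mem_univ _⟩
      simpa [Prod.zero_eq_mk] using hasDerivAt_const t ((0 : ℝ), (0 : ℝ))
    · simp [hu, hw]
  have := congrFun key x
  simpa [Prod.ext_iff] using this

theorem eq_of_eq (h : SolvesHill q u w) (h' : SolvesHill q u' w') {C x₀ : ℝ}
    (hq : ∀ x, |q x| ≤ C) (hu : u x₀ = u' x₀) (hw : w x₀ = w' x₀) (x : ℝ) :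
    u x = u' x ∧ w x = w' x := by
  have := (h.sub h').eq_zero hq (sub_eq_zero.2 hu) (sub_eq_zero.2 hw) x
  exact ⟨sub_eq_zero.1 this.1, sub_eq_zero.1 this.2⟩

/-- The derivative of the Wronskian of solutions of two Hill equations. -/
lemma hasDerivAt_wronskian {q' : ℝ → ℝ} (h : SolvesHill q u w) (h' : SolvesHill q' u' w')
    (x : ℝ) : HasDerivAt (fun x => w x * u' x - u x * w' x) ((q x - q' x) * (u x * u' x)) x :=
  (((h.2 x).mul (h'.1 x)).sub ((h.1 x).mul (h'.2 x))).congr_deriv (by ring)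

lemma wronskian_eq (h : SolvesHill q u w) (h' : SolvesHill q u' w') (x y : ℝ) :
    w x * u' x - u x * w' x = w y * u' y - u y * w' y :=
  is_const_of_deriv_eq_zero (fun x => (h.hasDerivAt_wronskian h' x).differentiableAt)
    (fun x => by rw [(h.hasDerivAt_wronskian h' x).deriv]; ring) x y

end SolvesHill

/-- The solutions of `u'' = (q - μ) u` with `u(0) = 1`, `u'(0) = 0`, and their continuous dependence
on the spectral parameter. -/
theorem exists_solvesHill_family {q : ℝ → ℝ} (hq : Continuous q) :
    ∃ u w : ℝ → ℝ → ℝ, (∀ μ, SolvesHill (fun x => q x - μ) (u μ) (w μ)) ∧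
      (∀ μ, u μ 0 = 1) ∧ (∀ μ, w μ 0 = 0) ∧
      ∀ x, Continuous (fun μ => u μ x) ∧ Continuous (fun μ => w μ x) := by
  -- First order system: `S (u, w) = (w, 0)` and `T (u, w) = (0, u)`, so the coefficient is `S + (q
  -- - μ) T`.
  let S : ℝ × ℝ →L[ℝ] ℝ × ℝ :=
    (ContinuousLinearMap.inl ℝ ℝ ℝ).comp (ContinuousLinearMap.snd ℝ ℝ ℝ)
  let T : ℝ × ℝ →L[ℝ] ℝ × ℝ :=
    (ContinuousLinearMap.inr ℝ ℝ ℝ).comp (ContinuousLinearMap.fst ℝ ℝ ℝ)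
  obtain ⟨y, h0, hd, hc⟩ := exists_linear_ode_family
    (A := fun μ x => S + (q x - μ) • T)
    (by
      have : Continuous fun z : ℝ × ℝ => S + (q z.2 - z.1) • T := by fun_prop
      exact this) ((1 : ℝ), (0 : ℝ))
  have hd1 : ∀ μ x, HasDerivAt (fun x => (y μ x).1) (y μ x).2 x := fun μ x => by
    have := (ContinuousLinearMap.fst ℝ ℝ ℝ).hasFDerivAt.comp_hasDerivAt x (hd μ x)
    simpa [S, T, Function.comp_def] using this
  have hd2 : ∀ μ x, HasDerivAt (fun x => (y μ x).2) ((q x - μ) * (y μ x).1) x := fun μ x => by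
    have := (ContinuousLinearMap.snd ℝ ℝ ℝ).hasFDerivAt.comp_hasDerivAt x (hd μ x)
    simpa [S, T, Function.comp_def] using this
  exact ⟨fun μ x => (y μ x).1, fun μ x => (y μ x).2, fun μ => ⟨hd1 μ, hd2 μ⟩,
    fun μ => by simp [h0], fun μ => by simp [h0], fun x => ⟨(hc x).fst, (hc x).snd⟩⟩

/-- Continuity at an endpoint of the function appearing in Jacobi's identity. -/
lemma tendsto_sq_mul_div {v g h : ℝ → ℝ} {a v' g' : ℝ} (hv : HasDerivAt v v' a)
    (hg : HasDerivAt g g' a) (hg' : g' ≠ 0) (hv0 : v a = 0) (hg0 : g a = 0)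
    (hh : ContinuousAt h a) : ContinuousAt (fun x => v x ^ 2 * h x / g x) a := by
  rw [continuousAt_iff_punctured_nhds]
  have h1 := hv.tendsto_slope
  have h2 := hg.tendsto_slope
  have h3 : Filter.Tendsto v (𝓝[≠] a) (𝓝 0) := by
    simpa [hv0] using (continuousAt_iff_punctured_nhds.1 hv.continuousAt)
  have h4 := continuousAt_iff_punctured_nhds.1 hh
  have h5 := (((h3.mul h1).mul h4).div h2 hg')
  -- The value at `a` is `0` by the convention for division by zero. This is also the limit, because
  -- the quotient equals `v * slope v * h / slope g` off `a` and `v` tends to `0`.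
  simp only [hv0, hg0, zero_mul, zero_div, div_zero] at h5 ⊢
  refine h5.congr' ?_
  filter_upwards [self_mem_nhdsWithin] with x hx
  have hx' : x - a ≠ 0 := sub_ne_zero.2 hx
  simp only [slope_def_field, hv0, hg0, sub_zero, Pi.div_apply]
  by_cases hgx : g x = 0
  · simp [hgx]
  · field_simp

/-- Jacobi's inequality: the quadratic form of `-∂² + q` is nonnegative on functions that vanish
at two consecutive zeros `a < b` of a solution `g` of `g'' = q g`. -/
theorem SolvesHill.jacobi {q g h v v' : ℝ → ℝ} (hg : SolvesHill q g h) (hq : Continuous q)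
    {a b : ℝ} (hab : a ≤ b) (hne : ∀ x ∈ Ioo a b, g x ≠ 0) (ha : g a = 0) (hb : g b = 0)
    (ha' : h a ≠ 0) (hb' : h b ≠ 0) (hv : ∀ x, HasDerivAt v (v' x) x) (hv' : Continuous v')
    (hva : v a = 0) (hvb : v b = 0) : 0 ≤ ∫ x in a..b, (v' x ^ 2 + q x * v x ^ 2) := by
  have hvc : Continuous v := continuous_iff_continuousAt.2 fun x => (hv x).continuousAt
  -- The Riccati function `r = h / g` satisfies `r' = q - r²`, so the integrand is the derivative of
  -- `v² r` plus the square `(v' - v r)²`, which is dropped below.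
  have hderiv : ∀ x ∈ Ioo a b, HasDerivAt (fun x => v x ^ 2 * h x / g x)
      (v' x ^ 2 + q x * v x ^ 2 - (v' x - v x * h x / g x) ^ 2) x := by
    intro x hx
    have hgx := hne x hx
    refine ((((hv x).pow 2).mul (hg.2 x)).div (hg.1 x) hgx).congr_deriv ?_
    simp only [Pi.mul_apply, Pi.pow_apply]
    field_simp
    ring
  have hcont : ContinuousOn (fun x => v x ^ 2 * h x / g x) (Icc a b) := by
    intro x hx
    refine ContinuousAt.continuousWithinAt ?_
    rcases eq_or_lt_of_le hx.1 with rfl | h1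
    · exact tendsto_sq_mul_div (hv a) (hg.1 a) ha' hva ha hg.continuous_right.continuousAt
    rcases eq_or_lt_of_le hx.2 with rfl | h2
    · exact tendsto_sq_mul_div (hv x) (hg.1 x) hb' hvb hb hg.continuous_right.continuousAt
    exact (hderiv x ⟨h1, h2⟩).continuousAt
  have hint : Continuous fun x => v' x ^ 2 + q x * v x ^ 2 := by fun_prop
  have := intervalIntegral.sub_le_integral_of_hasDeriv_right_of_le hab hcont
    (fun x hx => (hderiv x hx).hasDerivWithinAt) (hint.integrableOn_Icc)
    (fun x _ => sub_le_self _ (sq_nonneg _))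
  simpa [ha, hb] using this

/-! ### Weak derivatives on the circle, regular representatives and parity. -/

variable {L ω γ c : ℝ} {p : ℕ}

/-- A smooth function supported in `(0, L)` extends from `(0, L]` to a smooth periodic function. -/
lemma exists_smooth_periodic_extension (hL : 0 < L) {g : ℝ → ℝ} (hg : ContDiff ℝ (⊤ : ℕ∞) g)
    (hs : tsupport g ⊆ Ioo 0 L) :
    ∃ G : ℝ → ℝ, ContDiff ℝ (⊤ : ℕ∞) G ∧ Function.Periodic G L ∧ ∀ x ∈ Ioc 0 L, G x = g x := by
  have hzero : ∀ x, x ∉ Ioo 0 L → g x = 0 := fun x hx =>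
    image_eq_zero_of_notMem_tsupport fun h => hx (hs h)
  refine ⟨fun x => g (toIocMod hL 0 x), ?_, fun x => by simp, fun x hx => ?_⟩
  · refine contDiff_iff_contDiffAt.2 fun x => ?_
    set n := toIocDiv hL 0 x with hn
    have hx : x - n • L ∈ Ioc 0 (0 + L) := sub_toIocDiv_zsmul_mem_Ioc hL 0 x
    -- The second translate covers the junction `x - n • L = L`, where the index jumps. On the
    -- window `(0, 2L)` at most one of the two summands is nonzero.
    have hsm : ContDiffAt ℝ (⊤ : ℕ∞) (fun y => g (y - n • L) + g (y - (n + 1) • L)) x :=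
      ((hg.comp (contDiff_id.sub contDiff_const)).add
        (hg.comp (contDiff_id.sub contDiff_const))).contDiffAt
    refine hsm.congr_of_eventuallyEq ?_
    have hcont : Continuous fun y : ℝ => y - n • L := by fun_prop
    filter_upwards [hcont.continuousAt.preimage_mem_nhds
      (isOpen_Ioo.mem_nhds (show x - n • L ∈ Ioo 0 (2 * L) from
        ⟨hx.1, by linarith [hx.2]⟩))] with y hy
    have e : y - (n + 1) • L = y - n • L - L := by rw [add_smul, one_smul]; ring
    have hy1 : 0 < y - n • L := hy.1
    have hy2 : y - n • L < 2 * L := hy.2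
    rcases le_or_gt (y - n • L) L with h | h
    · have h1 : toIocMod hL 0 y = y - n • L :=
        (toIocMod_eq_iff hL).2 ⟨⟨hy1, by linarith⟩, n, by ring⟩
      rw [h1, hzero (y - (n + 1) • L) (fun h' => by rw [e] at h'; linarith [h'.1]), add_zero]
    · have h1 : toIocMod hL 0 y = y - (n + 1) • L :=
        (toIocMod_eq_iff hL).2 ⟨⟨by rw [e]; linarith, by rw [e]; linarith⟩, n + 1, by ring⟩
      rw [h1, hzero (y - n • L) (fun h' => by linarith [h'.2]), zero_add]
  · have : toIocMod hL 0 x = x := (toIocMod_eq_self hL).2 (by simpa using hx)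
    simp only [this]

/-- The smooth periodic functions separate integrable functions. -/
lemma ae_eq_zero_of_integral_mul_periodic (hL : 0 < L) {f : ℝ → ℝ}
    (hf : Integrable f (volume.restrict (Ioc 0 L)))
    (h : ∀ G : ℝ → ℝ, ContDiff ℝ (⊤ : ℕ∞) G → Function.Periodic G L → ∫ x in Ioc 0 L, f x * G x = 0) :
    f =ᵐ[volume.restrict (Ioc 0 L)] 0 := by
  rw [← Measure.restrict_congr_set Ioo_ae_eq_Ioc]
  have hfo : IntegrableOn f (Ioo 0 L) := IntegrableOn.mono_set hf Ioo_subset_Ioc_self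
  rw [Filter.EventuallyEq, ae_restrict_iff' measurableSet_Ioo]
  refine IsOpen.ae_eq_zero_of_integral_contDiff_smul_eq_zero isOpen_Ioo
    hfo.locallyIntegrableOn fun g hg _ hs => ?_
  obtain ⟨G, hG, hGp, hGg⟩ := exists_smooth_periodic_extension hL hg hs
  rw [← h G hG hGp, ← setIntegral_eq_integral_of_forall_compl_eq_zero (s := Ioc 0 L)]
  · refine setIntegral_congr_fun measurableSet_Ioc fun x hx => ?_
    simp only [smul_eq_mul, hGg x hx, mul_comm]
  · intro x hx
    rw [image_eq_zero_of_notMem_tsupport fun h' => hx (Ioo_subset_Ioc_self (hs h')), zero_smul]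

lemma integrable_mul_continuous {f g : ℝ → ℝ} (hf : Integrable f (volume.restrict (Ioc 0 L)))
    (hg : Continuous g) : Integrable (fun x => f x * g x) (volume.restrict (Ioc 0 L)) := by
  obtain ⟨M, hM⟩ := (isCompact_Icc (a := (0 : ℝ)) (b := L)).exists_bound_of_continuousOn
    hg.continuousOn
  refine hf.mul_bdd (c := M) hg.aestronglyMeasurable ?_
  filter_upwards [ae_restrict_mem measurableSet_Ioc] with x hx
  exact hM x ⟨hx.1.le, hx.2⟩

lemma integral_Ioc_eq (hL : 0 < L) (f : ℝ → ℝ) :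
    ∫ x in Ioc 0 L, f x = ∫ x in (0 : ℝ)..L, f x := (intervalIntegral.integral_of_le hL.le).symm

lemma periodic_primitive {g : ℝ → ℝ} (hg : ∀ a b, IntervalIntegrable g volume a b)
    (hp : Function.Periodic g L) (h0 : ∫ x in (0 : ℝ)..L, g x = 0) (c : ℝ) :
    Function.Periodic (fun x => c + ∫ t in (0 : ℝ)..x, g t) L := by
  intro x
  have := hp.intervalIntegral_add_eq x 0
  rw [zero_add, h0] at this
  simp only
  rw [← intervalIntegral.integral_add_adjacent_intervals (hg 0 x) (hg x (x + L)), this, add_zero]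

/-- The lemma of du Bois-Reymond on the circle. -/
lemma ae_eq_const_of_integral_mul_deriv (hL : 0 < L) {f : ℝ → ℝ}
    (hf : Integrable f (volume.restrict (Ioc 0 L)))
    (h : ∀ η : ℝ → ℝ, ContDiff ℝ (⊤ : ℕ∞) η → Function.Periodic η L →
      ∫ x in Ioc 0 L, f x * deriv η x = 0) :
    ∃ c : ℝ, f =ᵐ[volume.restrict (Ioc 0 L)] fun _ => c := by
  set c : ℝ := (∫ x in Ioc 0 L, f x) / L with hc
  refine ⟨c, ?_⟩
  have key : (fun x => f x - c) =ᵐ[volume.restrict (Ioc 0 L)] 0 := by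
    refine ae_eq_zero_of_integral_mul_periodic hL (hf.sub (integrable_const c)) fun G hG hGp => ?_
    -- Subtracting the mean makes the primitive of `G` periodic, hence an admissible `η`.
    set m : ℝ := (∫ x in (0 : ℝ)..L, G x) / L with hm
    have hθ : Continuous fun x => G x - m := hG.continuous.sub continuous_const
    have hd : ∀ x, HasDerivAt (fun x => 0 + ∫ t in (0 : ℝ)..x, (G t - m)) (G x - m) x := fun x =>
      (hθ.integral_hasStrictDerivAt 0 x).hasDerivAt.const_add 0
    have hde : deriv (fun x => 0 + ∫ t in (0 : ℝ)..x, (G t - m)) = fun x => G x - m :=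
      funext fun x => (hd x).deriv
    have h1 := h (fun x => 0 + ∫ t in (0 : ℝ)..x, (G t - m))
      (contDiff_infty_iff_deriv.2 ⟨fun x => (hd x).differentiableAt, by
        rw [hde]; exact hG.sub contDiff_const⟩)
      (periodic_primitive (fun a b => hθ.intervalIntegrable a b)
        (fun x => by simp only [hGp x]) (by
          rw [intervalIntegral.integral_sub (hG.continuous.intervalIntegrable _ _)
            (by simp), intervalIntegral.integral_const, hm, smul_eq_mul]
          field_simp; ring) 0)
    rw [hde] at h1
    have e1 : ∫ x in Ioc 0 L, (f x - c) * G x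
        = ∫ x in Ioc 0 L, (f x * (G x - m) + m * f x - c * G x) := by
      congr 1; funext x; ring
    have hGi : Integrable G (volume.restrict (Ioc 0 L)) :=
      (hG.continuous.integrableOn_Icc).mono_set Ioc_subset_Icc_self
    have hi : Integrable (fun x => f x * (G x - m) + m * f x) (volume.restrict (Ioc 0 L)) :=
      (integrable_mul_continuous hf hθ).add (hf.const_mul m)
    beta_reduce at h1
    rw [e1, integral_sub hi
      (hGi.const_mul c), integral_add (integrable_mul_continuous hf hθ) (hf.const_mul m), h1,
      integral_const_mul, integral_const_mul, integral_Ioc_eq hL G, hc, hm]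
    ring
  filter_upwards [key] with x hx
  simpa [sub_eq_zero] using hx

lemma L2per.integrable (u : L2per L) : Integrable (u : ℝ → ℝ) (volume.restrict (Ioc 0 L)) :=
  (Lp.memLp u).integrable (by norm_num)

/-- An element of `H¹` is the primitive of its weak derivative. -/
theorem IsWeakDeriv.exists_primitive (hL : 0 < L) {u v : L2per L} (h : IsWeakDeriv u v)
    {g : ℝ → ℝ} (hgv : v =ᵐ[volume.restrict (Ioc 0 L)] g) :
    (∫ x in (0 : ℝ)..L, g x = 0) ∧
      ∃ c, u =ᵐ[volume.restrict (Ioc 0 L)] fun x => c + ∫ t in (0 : ℝ)..x, g t := by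
  have hgi : Integrable g (volume.restrict (Ioc 0 L)) := (L2per.integrable v).congr hgv
  have hgI : IntervalIntegrable g volume 0 L :=
    (intervalIntegrable_iff_integrableOn_Ioc_of_le hL.le).2 hgi
  have hmean : ∫ x in (0 : ℝ)..L, g x = 0 := by
    -- The constant test function gives mean zero, which is what makes the primitive periodic.
    have := h (fun _ => 1) contDiff_const (fun _ => rfl)
    simp only [deriv_const', mul_zero, integral_zero, mul_one] at this
    rw [← integral_Ioc_eq hL, ← integral_congr_ae hgv]
    linarith
  refine ⟨hmean, ?_⟩
  set F : ℝ → ℝ := fun x => ∫ t in (0 : ℝ)..x, g t with hF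
  -- As `g` is only integrable, integration by parts must be the one for absolutely continuous
  -- functions.
  have hFac : AbsolutelyContinuousOnInterval F 0 L :=
    hgI.absolutelyContinuousOnInterval_intervalIntegral (by simp)
  have hFi : Integrable F (volume.restrict (Ioc 0 L)) := by
    have := hFac.continuousOn
    rw [uIcc_of_le hL.le] at this
    exact this.integrableOn_Icc.mono_set Ioc_subset_Icc_self
  obtain ⟨c, hc⟩ := ae_eq_const_of_integral_mul_deriv hL ((L2per.integrable u).sub hFi)
    (fun η hη hp => by
      have hηd : Continuous (deriv η) := hη.continuous_deriv (by simp)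
      have h1 := h η hη hp
      have h2 := hFac.integral_mul_deriv_eq_deriv_mul
        (g := η) (hη.contDiffOn.of_le (by simp)).absolutelyContinuousOnInterval
      have h3 : ∫ x in (0 : ℝ)..L, deriv F x * η x = ∫ x in Ioc 0 L, v x * η x := by
        rw [← integral_Ioc_eq hL]
        refine integral_congr_ae ?_
        filter_upwards [hgv, ae_restrict_of_ae hgI.ae_hasDerivAt_integral,
          ae_restrict_mem measurableSet_Ioc] with x hx1 hx2 hx3
        rw [(hx2 (by rw [uIcc_of_le hL.le]; exact Ioc_subset_Icc_self hx3) 0 (by simp)).deriv, hx1]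
      have hF0 : F 0 = 0 := by simp [hF]
      have hFL : F L = 0 := hmean
      rw [hF0, hFL, h3, zero_mul, zero_mul, sub_zero, zero_sub, ← integral_Ioc_eq hL] at h2
      have e1 : ∫ x in Ioc 0 L, (u x - F x) * deriv η x
          = ∫ x in Ioc 0 L, (u x * deriv η x - F x * deriv η x) := by
        congr 1; funext x; ring
      simp only [Pi.sub_apply]
      rw [e1, integral_sub (integrable_mul_continuous (L2per.integrable u) hηd)
        (integrable_mul_continuous hFi hηd), h1, h2, sub_self])
  refine ⟨c, ?_⟩
  filter_upwards [hc] with x hx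
  simp only [Pi.sub_apply] at hx
  linarith

/-- The weak derivative is unique. -/
theorem IsWeakDeriv.unique (hL : 0 < L) {u v v' : L2per L} (h : IsWeakDeriv u v)
    (h' : IsWeakDeriv u v') : v = v' := by
  refine Lp.ext ?_
  have key : (fun x => v x - v' x) =ᵐ[volume.restrict (Ioc 0 L)] 0 := by
    refine ae_eq_zero_of_integral_mul_periodic hL
      ((L2per.integrable v).sub (L2per.integrable v')) fun G hG hGp => ?_
    have h1 := h G hG hGp
    have h2 := h' G hG hGp
    simp only [sub_mul]
    rw [integral_sub (integrable_mul_cont v hG.continuous) (integrable_mul_cont v' hG.continuous)]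
    linarith
  filter_upwards [key] with x hx
  simpa [sub_eq_zero] using hx

lemma IsWeakDeriv.weakDeriv_eq (hL : 0 < L) {u v : L2per L} (h : IsWeakDeriv u v) :
    weakDeriv u = v := by
  have hu : MemH1per u := ⟨v, h⟩
  rw [weakDeriv, dif_pos hu]
  exact hu.choose_spec.unique hL h

theorem IsWeakDeriv.exists_continuous_rep (hL : 0 < L) {u v : L2per L} (h : IsWeakDeriv u v) :
    ∃ U : ℝ → ℝ, Continuous U ∧ Function.Periodic U L ∧ u =ᵐ[volume.restrict (Ioc 0 L)] U := by
  set g : ℝ → ℝ := fun x => v (toIocMod hL 0 x) with hg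
  have hgp : Function.Periodic g L := fun x => by simp [hg]
  have hgv : v =ᵐ[volume.restrict (Ioc 0 L)] g := by
    filter_upwards [ae_restrict_mem measurableSet_Ioc] with x hx
    rw [hg]
    simp only [(toIocMod_eq_self hL (a := 0)).2 (by simpa using hx)]
  have hgI : IntervalIntegrable g volume 0 (0 + L) := by
    rw [zero_add]
    exact (intervalIntegrable_iff_integrableOn_Ioc_of_le hL.le).2
      ((L2per.integrable v).congr hgv)
  have hgI' := hgp.intervalIntegrable hL.ne' hgI
  obtain ⟨h0, c, hc⟩ := h.exists_primitive hL hgv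
  exact ⟨_, continuous_const.add (intervalIntegral.continuous_primitive hgI' 0),
    periodic_primitive hgI' hgp h0 c, hc⟩

/-- The bootstrapping step: a continuous weak derivative is a classical one. -/
theorem IsWeakDeriv.exists_hasDerivAt_rep (hL : 0 < L) {u v : L2per L} (h : IsWeakDeriv u v)
    {g : ℝ → ℝ} (hg : Continuous g) (hgp : Function.Periodic g L)
    (hgv : v =ᵐ[volume.restrict (Ioc 0 L)] g) :
    ∃ U : ℝ → ℝ, (∀ x, HasDerivAt U (g x) x) ∧ Function.Periodic U L ∧
      u =ᵐ[volume.restrict (Ioc 0 L)] U := by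
  obtain ⟨h0, c, hc⟩ := h.exists_primitive hL hgv
  exact ⟨_, fun x => (hg.integral_hasStrictDerivAt 0 x).hasDerivAt.const_add c,
    periodic_primitive (fun a b => hg.intervalIntegrable a b) hgp h0 c, hc⟩

/-- Continuous periodic functions that agree almost everywhere on a period agree. -/
lemma eq_of_ae_eq_of_periodic (hL : 0 < L) {f g : ℝ → ℝ} (hf : Continuous f) (hg : Continuous g)
    (hfp : Function.Periodic f L) (hgp : Function.Periodic g L)
    (h : f =ᵐ[volume.restrict (Ioc 0 L)] g) (x : ℝ) : f x = g x := by
  have h1 : EqOn f g (Ioc 0 L) := Measure.eqOn_of_ae_eq h hf.continuousOn hg.continuousOn (by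
    rw [interior_Ioc, closure_Ioo hL.ne]; exact Ioc_subset_Icc_self)
  obtain ⟨y, hy, hxy⟩ := (hfp.sub hgp).exists_mem_Ioc hL x 0
  have := h1 (by simpa using hy)
  simp only [Pi.sub_apply, this, sub_self] at hxy
  linarith

/-- Piecewise `C¹` periodic functions are in `H¹`. -/
lemma isWeakDeriv_of_hasDeriv_right (hL : 0 < L) {u v : L2per L} {U U' : ℝ → ℝ}
    (hU : ContinuousOn U (Icc 0 L)) (hUL : U L = U 0)
    (hd : ∀ x ∈ Ioo 0 L, HasDerivWithinAt U (U' x) (Ioi x) x)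
    (hu : u =ᵐ[volume.restrict (Ioc 0 L)] U) (hv : v =ᵐ[volume.restrict (Ioc 0 L)] U') :
    IsWeakDeriv u v := by
  intro η hη hp
  have hηd : Continuous (deriv η) := hη.continuous_deriv (by simp)
  have hI : IntervalIntegrable U' volume 0 L :=
    (intervalIntegrable_iff_integrableOn_Ioc_of_le hL.le).2 ((L2per.integrable v).congr hv)
  have h1 := intervalIntegral.integral_mul_deriv_eq_deriv_mul_of_hasDeriv_right
    (u := U) (v := η) (u' := U') (v' := deriv η) (a := 0) (b := L)
    (by rwa [uIcc_of_le hL.le]) hη.continuous.continuousOn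
    (by rwa [min_eq_left hL.le, max_eq_right hL.le])
    (fun x _ => ((hη.differentiable (by simp)) x).hasDerivAt.hasDerivWithinAt) hI
    (hηd.intervalIntegrable _ _)
  have hη0 : η L = η 0 := by simpa using hp 0
  rw [hUL, hη0, sub_self, zero_sub, ← integral_Ioc_eq hL, ← integral_Ioc_eq hL] at h1
  rw [integral_congr_ae (g := fun x => U x * deriv η x)
      (by filter_upwards [hu] with x hx; rw [hx]), h1,
    integral_congr_ae (f := fun x => U' x * η x) (g := fun x => v x * η x)
      (by filter_upwards [hv] with x hx; rw [hx])]

lemma isWeakDeriv_of_hasDerivAt (hL : 0 < L) {u v : L2per L} {U U' : ℝ → ℝ}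
    (hd : ∀ x, HasDerivAt U (U' x) x) (hp : Function.Periodic U L)
    (hu : u =ᵐ[volume.restrict (Ioc 0 L)] U) (hv : v =ᵐ[volume.restrict (Ioc 0 L)] U') :
    IsWeakDeriv u v :=
  isWeakDeriv_of_hasDeriv_right hL (fun x _ => (hd x).continuousAt.continuousWithinAt)
    (by simpa using hp 0) (fun x _ => (hd x).hasDerivWithinAt) hu hv

lemma memLp_of_bounded {f : ℝ → ℝ} (hf : AEStronglyMeasurable f (volume.restrict (Ioc 0 L)))
    {M : ℝ} (hM : ∀ x ∈ Ioc 0 L, |f x| ≤ M) : MemLp f 2 (volume.restrict (Ioc 0 L)) := by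
  refine MemLp.of_bound hf M ?_
  filter_upwards [ae_restrict_mem measurableSet_Ioc] with x hx using hM x hx

lemma memLp_of_continuous {f : ℝ → ℝ} (hf : Continuous f) :
    MemLp f 2 (volume.restrict (Ioc 0 L)) := by
  obtain ⟨M, hM⟩ := (isCompact_Icc (a := (0 : ℝ)) (b := L)).exists_bound_of_continuousOn
    hf.continuousOn
  exact memLp_of_bounded hf.aestronglyMeasurable fun x hx => hM x (Ioc_subset_Icc_self hx)

lemma exists_rep_of_continuous {f : ℝ → ℝ} (hf : Continuous f) :
    ∃ u : L2per L, u =ᵐ[volume.restrict (Ioc 0 L)] f :=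
  ⟨(memLp_of_continuous hf).toLp f, MemLp.coeFn_toLp _⟩

lemma bounded_of_periodic (hL : 0 < L) {f : ℝ → ℝ} (hf : Continuous f)
    (hp : Function.Periodic f L) : ∃ C, ∀ x, |f x| ≤ C := by
  obtain ⟨M, hM⟩ := (isCompact_Icc (a := (0 : ℝ)) (b := L)).exists_bound_of_continuousOn
    hf.continuousOn
  refine ⟨M, fun x => ?_⟩
  obtain ⟨y, hy, hxy⟩ := hp.exists_mem_Ioc hL x 0
  rw [hxy]
  exact hM y (Ioc_subset_Icc_self (by simpa using hy))

lemma ae_reflect {P : ℝ → Prop} (h : ∀ᵐ x ∂(volume.restrict (Ioc (0 : ℝ) L)), P x) :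
    ∀ᵐ x ∂(volume.restrict (Ioc (0 : ℝ) L)), P (L - x) := by
  -- The reflection `x ↦ L - x` preserves `(0, L)` but not `(0, L]`.
  rw [← Measure.restrict_congr_set Ioo_ae_eq_Ioc, ae_restrict_iff' measurableSet_Ioo] at h ⊢
  have h1 := (Measure.measurePreserving_sub_left volume L).quasiMeasurePreserving.ae h
  filter_upwards [h1] with x hx hx'
  exact hx ⟨by linarith [hx'.2], by linarith [hx'.1]⟩

lemma isOddPer_of_odd {u : L2per L} {U : ℝ → ℝ} (hu : u =ᵐ[volume.restrict (Ioc 0 L)] U)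
    (hp : Function.Periodic U L) (ho : Function.Odd U) : IsOddPer u := by
  filter_upwards [hu, ae_reflect hu] with x h1 h2
  rw [h2, h1, ← ho x, ← hp (-x)]
  congr 1; ring

lemma IsOddPer.odd (hL : 0 < L) {u : L2per L} {U : ℝ → ℝ} (h : IsOddPer u)
    (hu : u =ᵐ[volume.restrict (Ioc 0 L)] U) (hU : Continuous U)
    (hp : Function.Periodic U L) : Function.Odd U := by
  have h1 : ∀ x, U (-x) = - U x := by
    refine eq_of_ae_eq_of_periodic hL (by fun_prop) (by fun_prop) (fun x => ?_)
      (fun x => by simp only [hp x]) ?_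
    · rw [neg_add, ← sub_eq_add_neg]; exact hp.sub_eq _
    · filter_upwards [h, hu, ae_reflect hu] with x h1 h2 h3
      rw [h2, h3] at h1
      rw [← h1, ← hp (-x)]
      congr 1; ring
  exact h1

lemma IsOddPer.add {u v : L2per L} (hu : IsOddPer u) (hv : IsOddPer v) : IsOddPer (u + v) := by
  filter_upwards [hu, hv, Lp.coeFn_add u v, ae_reflect (Lp.coeFn_add u v)] with x h1 h2 h3 h4
  rw [h3, h4, Pi.add_apply, Pi.add_apply, h1, h2]; ring

lemma IsOddPer.smul {u : L2per L} (c : ℝ) (hu : IsOddPer u) : IsOddPer (c • u) := by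
  filter_upwards [hu, Lp.coeFn_smul c u, ae_reflect (Lp.coeFn_smul c u)] with x h1 h3 h4
  rw [h3, h4, Pi.smul_apply, Pi.smul_apply, h1, smul_neg]

lemma integral_eq_zero_of_odd (hL : 0 < L) {h : ℝ → ℝ} (hp : Function.Periodic h L)
    (ho : Function.Odd h) : ∫ x in Ioc 0 L, h x = 0 := by
  rw [integral_Ioc_eq hL]
  have h1 : ∫ x in (0 : ℝ)..L, h (L - x) = ∫ x in (0 : ℝ)..L, h x := by
    rw [intervalIntegral.integral_comp_sub_left]; simp
  have h2 : ∀ x, h (L - x) = - h x := fun x => by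
    rw [← ho x, ← hp (-x)]; congr 1; ring
  simp only [h2, intervalIntegral.integral_neg] at h1
  linarith

/-! ### The minimization problem: Euler–Lagrange equation, regularity, absence of interior zeros. -/

lemma B_eq (hL : 0 < L) {u v : L2per L} (h : IsWeakDeriv u v) {U V : ℝ → ℝ}
    (hu : u =ᵐ[volume.restrict (Ioc 0 L)] U) (hv : v =ᵐ[volume.restrict (Ioc 0 L)] V) :
    B L ω u = (1 / 2) * ∫ x in Ioc 0 L, (V x ^ 2 + ω * U x ^ 2) := by
  rw [B, h.weakDeriv_eq hL]
  congr 1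
  refine integral_congr_ae ?_
  filter_upwards [hu, hv] with x h1 h2
  rw [h1, h2]

lemma B_smul (hL : 0 < L) {u v : L2per L} (h : IsWeakDeriv u v) (s : ℝ) :
    B L ω (s • u) = s ^ 2 * B L ω u := by
  rw [B_eq hL (h.smul s) (Lp.coeFn_smul s u) (Lp.coeFn_smul s v),
    B_eq hL h (Filter.EventuallyEq.refl _ _) (Filter.EventuallyEq.refl _ _), mul_left_comm,
    ← integral_const_mul (s ^ 2)]
  congr 2
  funext x
  simp only [Pi.smul_apply, smul_eq_mul]; ring

lemma B_nonneg (hω : 0 < ω) (u : L2per L) : 0 ≤ B L ω u :=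
  mul_nonneg (by norm_num) (integral_nonneg fun x => by positivity)

/-- The minimization property in its scale invariant form. -/
lemma minimizer_scaled (hL : 0 < L) (hω : 0 < ω) (hγ : 0 < γ) {ψ : L2per L}
    (hmin : IsMinOn (B L ω) (Z L p γ) ψ) {u v : L2per L} (h : IsWeakDeriv u v)
    (ho : IsOddPer u) (hN : 0 < ∫ x in Ioc 0 L, u x ^ (p + 2)) :
    B L ω ψ ^ (p + 2) * (∫ x in Ioc 0 L, u x ^ (p + 2)) ^ 2 ≤ γ ^ 2 * B L ω u ^ (p + 2) := by
  set N := ∫ x in Ioc 0 L, u x ^ (p + 2) with hNdef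
  -- The factor that puts `s • u` on the constraint. Since `B` is quadratic, taking the power `p +
  -- 2` eliminates the root and leaves a polynomial inequality.
  set s : ℝ := (γ / N) ^ (((p + 2 : ℕ) : ℝ)⁻¹) with hs
  have hsp : s ^ (p + 2) = γ / N := Real.rpow_inv_natCast_pow (by positivity) (by omega)
  have hmem : s • u ∈ Z L p γ := by
    refine ⟨⟨_, h.smul s⟩, ho.smul s, ?_⟩
    rw [integral_congr_ae (g := fun x => s ^ (p + 2) * u x ^ (p + 2))
      (by filter_upwards [Lp.coeFn_smul s u] with x hx
          rw [hx, Pi.smul_apply, smul_eq_mul, mul_pow]), integral_const_mul, hsp, ← hNdef]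
    field_simp
  have h1 : B L ω ψ ≤ B L ω (s • u) := hmin hmem
  rw [B_smul hL h] at h1
  have h2 := pow_le_pow_left₀ (B_nonneg hω ψ) h1 (p + 2)
  rw [mul_pow, ← pow_mul, mul_comm 2, pow_mul, hsp] at h2
  calc B L ω ψ ^ (p + 2) * N ^ 2
      ≤ ((γ / N) ^ 2 * B L ω u ^ (p + 2)) * N ^ 2 := by gcongr
    _ = γ ^ 2 * B L ω u ^ (p + 2) := by field_simp

lemma B_pos (hω : 0 < ω) (hγ : 0 < γ) {ψ : L2per L} (hψ : ψ ∈ Z L p γ) :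
    0 < B L ω ψ := by
  refine (B_nonneg hω ψ).lt_of_ne' fun h0 => ?_
  have hi : Integrable (fun x => weakDeriv ψ x ^ 2 + ω * ψ x ^ 2)
      (volume.restrict (Ioc 0 L)) :=
    (Lp.memLp (weakDeriv ψ)).integrable_sq.add ((Lp.memLp ψ).integrable_sq.const_mul ω)
  have h1 : ∫ x in Ioc 0 L, (weakDeriv ψ x ^ 2 + ω * ψ x ^ 2) = 0 := by
    rw [B] at h0; linarith
  rw [integral_eq_zero_iff_of_nonneg (fun x => by positivity) hi] at h1
  have h2 : ∫ x in Ioc 0 L, ψ x ^ (p + 2) = 0 := by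
    refine integral_eq_zero_of_ae ?_
    filter_upwards [h1] with x hx
    simp only [Pi.zero_apply] at hx ⊢
    have : ψ x ^ 2 = 0 := by
      have := sq_nonneg (weakDeriv ψ x)
      have := sq_nonneg (ψ x)
      nlinarith
    rw [pow_add, this, mul_zero]
  linarith [hψ.2.2]

lemma hasDerivAt_integral_add_pow {f w : ℝ → ℝ} (hf : Continuous f) (hw : Continuous w) (n : ℕ) :
    HasDerivAt (fun t : ℝ => ∫ x in Ioc 0 L, (f x + t * w x) ^ (n + 1))
      (∫ x in Ioc 0 L, (n + 1) * f x ^ n * w x) 0 := by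
  obtain ⟨M, hM⟩ := (isCompact_Icc (a := (0 : ℝ)) (b := L)).exists_bound_of_continuousOn
    hf.continuousOn
  obtain ⟨K, hK⟩ := (isCompact_Icc (a := (0 : ℝ)) (b := L)).exists_bound_of_continuousOn
    hw.continuousOn
  have key := (hasDerivAt_integral_of_dominated_loc_of_deriv_le
    (μ := volume.restrict (Ioc 0 L)) (F := fun t x => (f x + t * w x) ^ (n + 1))
    (F' := fun t x => (n + 1) * (f x + t * w x) ^ n * w x) (x₀ := (0 : ℝ))
    (s := Metric.ball 0 1) (bound := fun _ => (n + 1) * (M + K) ^ n * K)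
    (Metric.ball_mem_nhds 0 one_pos) ?_ ?_ ?_ ?_ ?_ ?_).2
  · simpa using key
  · exact Filter.Eventually.of_forall fun t => by
      have : Continuous fun x => (f x + t * w x) ^ (n + 1) := by fun_prop
      exact this.aestronglyMeasurable
  · have : Continuous fun x => (f x + 0 * w x) ^ (n + 1) := by fun_prop
    exact this.integrableOn_Icc.mono_set Ioc_subset_Icc_self
  · have : Continuous fun x => (n + 1) * (f x + 0 * w x) ^ n * w x := by fun_prop
    exact this.aestronglyMeasurable
  · filter_upwards [ae_restrict_mem measurableSet_Ioc] with x hx t ht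
    have h1 : |f x| ≤ M := hM x (Ioc_subset_Icc_self hx)
    have h2 : |w x| ≤ K := hK x (Ioc_subset_Icc_self hx)
    have hK0 : 0 ≤ K := (abs_nonneg _).trans h2
    have ht' : |t| ≤ 1 := by
      have := mem_ball_zero_iff.1 ht
      exact (Real.norm_eq_abs t ▸ this).le
    have h3 : |f x + t * w x| ≤ M + K := by
      refine (abs_add_le _ _).trans (add_le_add h1 ?_)
      rw [abs_mul]
      exact (mul_le_mul ht' h2 (abs_nonneg _) zero_le_one).trans (one_mul K).le
    rw [Real.norm_eq_abs, abs_mul, abs_mul, abs_pow, abs_of_nonneg (by positivity : (0 : ℝ) ≤ n + 1)]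
    have hMK : 0 ≤ M + K := add_nonneg ((abs_nonneg _).trans h1) hK0
    gcongr
  · exact integrable_const _
  · refine Filter.Eventually.of_forall fun x t _ => ?_
    have h1 : HasDerivAt (fun t => f x + t * w x) (w x) t := by
      simpa using ((hasDerivAt_id t).mul_const (w x)).const_add (f x)
    simpa using h1.fun_pow (n + 1)

/-- The Euler–Lagrange equation, tested against an odd function. -/
lemma euler_lagrange_odd (hL : 0 < L) (hω : 0 < ω) (hγ : 0 < γ) {ψ v : L2per L}
    (hψ : ψ ∈ Z L p γ) (hmin : IsMinOn (B L ω) (Z L p γ) ψ) (hv : IsWeakDeriv ψ v)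
    {Ψ : ℝ → ℝ} (hΨ : Continuous Ψ) (hψΨ : ψ =ᵐ[volume.restrict (Ioc 0 L)] Ψ)
    {w w' : ℝ → ℝ} (hw : ∀ x, HasDerivAt w (w' x) x) (hw' : Continuous w')
    (hwp : Function.Periodic w L) (hwo : Function.Odd w) :
    ∫ x in Ioc 0 L, v x * w' x =
      - ∫ x in Ioc 0 L, (ω * Ψ x - 2 * B L ω ψ / γ * Ψ x ^ (p + 1)) * w x := by
  have hwc : Continuous w := continuous_iff_continuousAt.2 fun x => (hw x).continuousAt
  obtain ⟨W, hW⟩ := exists_rep_of_continuous (L := L) hwc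
  obtain ⟨W', hW'⟩ := exists_rep_of_continuous (L := L) hw'
  have hWW' : IsWeakDeriv W W' := isWeakDeriv_of_hasDerivAt hL hw hwp hW hW'
  set B₀ := B L ω ψ with hB₀
  have hB₀pos : 0 < B₀ := B_pos hω hγ hψ
  set N : ℝ → ℝ := fun t => ∫ x in Ioc 0 L, (Ψ x + t * w x) ^ (p + 2) with hN
  set b : ℝ := ∫ x in Ioc 0 L, (v x * w' x + ω * (Ψ x * w x)) with hb
  set e : ℝ := ∫ x in Ioc 0 L, (w' x ^ 2 + ω * w x ^ 2) with he
  have hN0 : N 0 = γ := by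
    rw [← hψ.2.2]
    refine integral_congr_ae ?_
    filter_upwards [hψΨ] with x hx
    rw [hx]; simp
  have hNd := hasDerivAt_integral_add_pow (L := L) hΨ hwc (p + 1)
  have hadd : ∀ t : ℝ, (ψ + t • W : L2per L) =ᵐ[volume.restrict (Ioc 0 L)]
      fun x => Ψ x + t * w x := fun t => by
    filter_upwards [hψΨ, hW, Lp.coeFn_add ψ (t • W), Lp.coeFn_smul t W] with x h1 h2 h3 h4
    rw [h3, Pi.add_apply, h4, Pi.smul_apply, h1, h2, smul_eq_mul]
  have hadd' : ∀ t : ℝ, (v + t • W' : L2per L) =ᵐ[volume.restrict (Ioc 0 L)]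
      fun x => v x + t * w' x := fun t => by
    filter_upwards [hW', Lp.coeFn_add v (t • W'), Lp.coeFn_smul t W'] with x h2 h3 h4
    rw [h3, Pi.add_apply, h4, Pi.smul_apply, h2, smul_eq_mul]
  have hci : ∀ f : ℝ → ℝ, Continuous f → Integrable f (volume.restrict (Ioc 0 L)) :=
    fun f hf => hf.integrableOn_Icc.mono_set Ioc_subset_Icc_self
  have hBt : ∀ t : ℝ, B L ω (ψ + t • W) = B₀ + t * b + t ^ 2 * (e / 2) := by
    intro t
    rw [B_eq hL (hv.add (hWW'.smul t)) (hadd t) (hadd' t), hB₀,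
      B_eq hL hv hψΨ (Filter.EventuallyEq.refl _ _)]
    have i1 : Integrable (fun x => v x ^ 2 + ω * Ψ x ^ 2) (volume.restrict (Ioc 0 L)) :=
      (Lp.memLp v).integrable_sq.add (hci _ (by fun_prop))
    have i2 : Integrable (fun x => 2 * t * (v x * w' x + ω * (Ψ x * w x)))
        (volume.restrict (Ioc 0 L)) :=
      ((integrable_mul_cont v hw').add (hci _ (by fun_prop))).const_mul _
    have i3 : Integrable (fun x => t ^ 2 * (w' x ^ 2 + ω * w x ^ 2))
        (volume.restrict (Ioc 0 L)) := hci _ (by fun_prop)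
    have i12 : Integrable (fun x => (v x ^ 2 + ω * Ψ x ^ 2) +
        2 * t * (v x * w' x + ω * (Ψ x * w x))) (volume.restrict (Ioc 0 L)) := i1.add i2
    have e1 : ∫ x in Ioc 0 L, ((v x + t * w' x) ^ 2 + ω * (Ψ x + t * w x) ^ 2)
        = ∫ x in Ioc 0 L, ((v x ^ 2 + ω * Ψ x ^ 2) +
          2 * t * (v x * w' x + ω * (Ψ x * w x)) + t ^ 2 * (w' x ^ 2 + ω * w x ^ 2)) := by
      congr 1; funext x; ring
    rw [e1, integral_add i12 i3, integral_add i1 i2, integral_const_mul, integral_const_mul,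
      ← hb, ← he]
    ring
  -- The scale invariant inequality along `ψ + t W` says `h ≥ 0 = h 0` near `0`; `h' 0 = 0` yields
  -- the multiplier `2 B₀ / γ` without staying on the constraint set.
  set h : ℝ → ℝ := fun t =>
    γ ^ 2 * (B₀ + t * b + t ^ 2 * (e / 2)) ^ (p + 2) - B₀ ^ (p + 2) * N t ^ 2 with hh
  have hh0 : h 0 = 0 := by simp only [hh, hN0]; ring
  have hloc : IsLocalMin h 0 := by
    have hpos : ∀ᶠ t in 𝓝 (0 : ℝ), 0 < N t :=
      hNd.continuousAt.eventually_const_lt (by rw [← hN, hN0]; exact hγ)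
    filter_upwards [hpos] with t ht
    have hNt : ∫ x in Ioc 0 L, (ψ + t • W : L2per L) x ^ (p + 2) = N t := by
      refine integral_congr_ae ?_
      filter_upwards [hadd t] with x hx
      rw [hx]
    have := minimizer_scaled hL hω hγ hmin (hv.add (hWW'.smul t))
      (hψ.2.1.add ((isOddPer_of_odd hW hwp hwo).smul t)) (by rw [hNt]; exact ht)
    rw [hNt, hBt t] at this
    rw [hh0]
    exact sub_nonneg.2 this
  have hBd : HasDerivAt (fun t : ℝ => B₀ + t * b + t ^ 2 * (e / 2)) b 0 := by
    have h1 := (((hasDerivAt_id (0 : ℝ)).mul_const b).const_add B₀).add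
      (((hasDerivAt_id (0 : ℝ)).pow 2).mul_const (e / 2))
    exact h1.congr_deriv (by simp)
  have hder : HasDerivAt h (γ ^ 2 * ((p + 2 : ℕ) * B₀ ^ (p + 1) * b) - B₀ ^ (p + 2) *
      (2 * γ * ∫ x in Ioc 0 L, ((p + 1 : ℕ) + 1) * Ψ x ^ (p + 1) * w x)) 0 := by
    have h1 := ((hBd.pow (p + 2)).const_mul (γ ^ 2)).sub
      ((hNd.pow 2).const_mul (B₀ ^ (p + 2)))
    refine h1.congr_deriv ?_
    have hN0' : ∫ x in Ioc 0 L, (Ψ x + 0 * w x) ^ (p + 1 + 1) = γ := hN0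
    rw [hN0']
    simp
  have h0 := hloc.hasDerivAt_eq_zero hder
  have hIe : ∫ x in Ioc 0 L, ((p + 1 : ℕ) + 1) * Ψ x ^ (p + 1) * w x
      = (p + 2) * ∫ x in Ioc 0 L, Ψ x ^ (p + 1) * w x := by
    rw [← integral_const_mul]
    congr 1; funext x; push_cast; ring
  rw [hIe] at h0
  set I := ∫ x in Ioc 0 L, Ψ x ^ (p + 1) * w x with hI
  have hbI : b = 2 * B₀ / γ * I := by
    have h1 : (γ * (p + 2) * B₀ ^ (p + 1)) * (γ * b - 2 * B₀ * I) = 0 := by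
      push_cast at h0
      rw [← h0]; ring
    have h2 : γ * (p + 2) * B₀ ^ (p + 1) ≠ 0 := by positivity
    have h3 := (mul_eq_zero.1 h1).resolve_left h2
    field_simp
    linarith
  have hb2 : b = (∫ x in Ioc 0 L, v x * w' x) + ω * ∫ x in Ioc 0 L, Ψ x * w x := by
    rw [hb, integral_add (integrable_mul_cont v hw') (hci _ (by fun_prop)), integral_const_mul]
  have e2 : ∫ x in Ioc 0 L, (ω * Ψ x - 2 * B₀ / γ * Ψ x ^ (p + 1)) * w x
      = ω * (∫ x in Ioc 0 L, Ψ x * w x) - 2 * B₀ / γ * I := by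
    rw [hI, ← integral_const_mul, ← integral_const_mul,
      ← integral_sub (hci _ (by fun_prop)) (hci _ (by fun_prop))]
    congr 1; funext x; ring
  rw [e2, ← hbI, hb2]
  ring

/-- Minimizers are classical solutions of the Euler–Lagrange equation. -/
theorem exists_profile (hL : 0 < L) (hω : 0 < ω) (hγ : 0 < γ) (hp : Even p) {ψ : L2per L}
    (hψ : ψ ∈ Z L p γ) (hmin : IsMinOn (B L ω) (Z L p γ) ψ) :
    ∃ Ψ Ψ' : ℝ → ℝ, ψ =ᵐ[volume.restrict (Ioc 0 L)] Ψ ∧ Function.Periodic Ψ L ∧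
      Function.Odd Ψ ∧ (∀ x, HasDerivAt Ψ (Ψ' x) x) ∧ Function.Periodic Ψ' L ∧
      ∀ x, HasDerivAt Ψ' (ω * Ψ x - 2 * B L ω ψ / γ * Ψ x ^ (p + 1)) x := by
  obtain ⟨v, hv⟩ := hψ.1
  obtain ⟨Ψ, hΨ, hΨp, hψΨ⟩ := hv.exists_continuous_rep hL
  have hΨo : Function.Odd Ψ := hψ.2.1.odd hL hψΨ hΨ hΨp
  set c := 2 * B L ω ψ / γ with hc
  set f : ℝ → ℝ := fun x => ω * Ψ x - c * Ψ x ^ (p + 1) with hf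
  have hfc : Continuous f := by fun_prop
  have hfp : Function.Periodic f L := fun x => by simp only [hf, hΨp x]
  have hfo : Function.Odd f := fun x => by
    simp only [hf, hΨo x, hp.add_one.neg_pow]; ring
  obtain ⟨F, hF⟩ := exists_rep_of_continuous (L := L) hfc
  -- Split `η` into its odd and even parts. The odd part is an admissible variation. For the even
  -- part both sides vanish: `∫ f η_even = 0` by parity, and `∫ v η_even' = -∫ ψ η_even'' = 0`, on
  -- using the derivative of the even part itself as test function for `ψ`.
  have hvF : IsWeakDeriv v F := by
    intro η hη hηp
    have hηd : ContDiff ℝ (⊤ : ℕ∞) (deriv η) := (contDiff_infty_iff_deriv.1 hη).2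
    have hηdd : ContDiff ℝ (⊤ : ℕ∞) (deriv (deriv η)) := (contDiff_infty_iff_deriv.1 hηd).2
    have hd1 : ∀ x, HasDerivAt η (deriv η x) x := fun x =>
      (hη.differentiable (by simp) x).hasDerivAt
    have hd2 : ∀ x, HasDerivAt (deriv η) (deriv (deriv η) x) x := fun x =>
      (hηd.differentiable (by simp) x).hasDerivAt
    have hneg : ∀ x : ℝ, HasDerivAt (fun x : ℝ => -x) (-1) x := fun x => hasDerivAt_neg x
    have hηpn : ∀ x, η (-(x + L)) = η (-x) := fun x => by
      rw [neg_add, ← sub_eq_add_neg]; exact hηp.sub_eq _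
    have hηdp : Function.Periodic (deriv η) L := fun x => by
      rw [← deriv_comp_add_const]; congr 1; funext y; exact hηp y
    have hηddp : Function.Periodic (deriv (deriv η)) L := fun x => by
      rw [← deriv_comp_add_const]; congr 1; funext y; exact hηdp y
    have ho := euler_lagrange_odd hL hω hγ hψ hmin hv hΨ hψΨ
      (w := fun x => η x - η (-x)) (w' := fun x => deriv η x + deriv η (-x))
      (fun x => ((hd1 x).sub ((hd1 (-x)).comp x (hneg x))).congr_deriv (by ring))
      (by have := hηd.continuous; fun_prop)
      (fun x => by simp only [hηp x, hηpn x]) (fun x => by simp only [neg_neg]; ring)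
    have he1 := hv (fun x => deriv η x - deriv η (-x))
      (hηd.sub (hηd.comp contDiff_neg))
      (fun x => by
        simp only [hηdp x]
        rw [neg_add, ← sub_eq_add_neg, hηdp.sub_eq])
    have hde : deriv (fun x => deriv η x - deriv η (-x))
        = fun x => deriv (deriv η) x + deriv (deriv η) (-x) := funext fun x =>
      (((hd2 x).sub ((hd2 (-x)).comp x (hneg x))).congr_deriv (by ring)).deriv
    rw [hde] at he1
    have he2 : ∫ x in Ioc 0 L, ψ x * (deriv (deriv η) x + deriv (deriv η) (-x)) = 0 := by
      rw [integral_congr_ae (g := fun x => Ψ x * (deriv (deriv η) x + deriv (deriv η) (-x)))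
        (by filter_upwards [hψΨ] with x hx; rw [hx])]
      refine integral_eq_zero_of_odd hL (fun x => ?_) (fun x => ?_)
      · simp only [hΨp x, hηddp x]
        rw [neg_add, ← sub_eq_add_neg, hηddp.sub_eq]
      · simp only [hΨo x, neg_neg]; ring
    have he3 : ∫ x in Ioc 0 L, f x * (η x + η (-x)) = 0 := by
      refine integral_eq_zero_of_odd hL (fun x => ?_) (fun x => ?_)
      · simp only [hfp x, hηp x, hηpn x]
      · simp only [hfo x, neg_neg]; ring
    simp only at he1
    rw [he2] at he1
    have hc1 : Continuous fun x => deriv η x + deriv η (-x) := by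
      have := hηd.continuous; fun_prop
    have hc2 : Continuous fun x => deriv η x - deriv η (-x) := by
      have := hηd.continuous; fun_prop
    have hci : ∀ f : ℝ → ℝ, Continuous f → Integrable f (volume.restrict (Ioc 0 L)) :=
      fun f hf => hf.integrableOn_Icc.mono_set Ioc_subset_Icc_self
    have s1 : 2 * ∫ x in Ioc 0 L, v x * deriv η x
        = (∫ x in Ioc 0 L, v x * (deriv η x + deriv η (-x)))
          + ∫ x in Ioc 0 L, v x * (deriv η x - deriv η (-x)) := by
      rw [← integral_add (integrable_mul_cont v hc1) (integrable_mul_cont v hc2),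
        ← integral_const_mul]
      congr 1; funext x; ring
    have hηc := hη.continuous
    have s2 : 2 * ∫ x in Ioc 0 L, f x * η x
        = (∫ x in Ioc 0 L, f x * (η x - η (-x))) + ∫ x in Ioc 0 L, f x * (η x + η (-x)) := by
      rw [← integral_add (hci _ (by fun_prop)) (hci _ (by fun_prop)), ← integral_const_mul]
      congr 1; funext x; ring
    rw [integral_congr_ae (f := fun x => F x * η x) (g := fun x => f x * η x)
      (by filter_upwards [hF] with x hx; rw [hx])]
    have ho' : ∫ x in Ioc 0 L, v x * (deriv η x + deriv η (-x))
      = - ∫ x in Ioc 0 L, f x * (η x - η (-x)) := ho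
    linarith
  obtain ⟨Ψ', hΨ', hΨ'p, hvΨ'⟩ := hvF.exists_hasDerivAt_rep hL hfc hfp hF
  have hΨ'c : Continuous Ψ' := continuous_iff_continuousAt.2 fun x => (hΨ' x).continuousAt
  obtain ⟨U, hU, hUp, hψU⟩ := hv.exists_hasDerivAt_rep hL hΨ'c hΨ'p hvΨ'
  have hUΨ : U = Ψ := funext (eq_of_ae_eq_of_periodic hL
    (continuous_iff_continuousAt.2 fun x => (hU x).continuousAt) hΨ hUp hΨp
    (hψU.symm.trans hψΨ))
  rw [hUΨ] at hU
  exact ⟨Ψ, Ψ', hψΨ, hΨp, hΨo, hU, hΨ'p, fun x => hΨ' x⟩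

/-- Periodic solutions of `φ'' = ω φ - c φ^(p+1)` are determined by their Cauchy data. -/
theorem profile_eq_of_eq (hL : 0 < L) {φ φ' χ χ' : ℝ → ℝ} (hφp : Function.Periodic φ L)
    (hχp : Function.Periodic χ L) (hφ : ∀ x, HasDerivAt φ (φ' x) x)
    (hφ' : ∀ x, HasDerivAt φ' (ω * φ x - c * φ x ^ (p + 1)) x)
    (hχ : ∀ x, HasDerivAt χ (χ' x) x)
    (hχ' : ∀ x, HasDerivAt χ' (ω * χ x - c * χ x ^ (p + 1)) x) {x₀ : ℝ}
    (h0 : φ x₀ = χ x₀) (h1 : φ' x₀ = χ' x₀) (x : ℝ) : φ x = χ x ∧ φ' x = χ' x := by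
  -- The difference quotient of `s ↦ ω s - c s^(p+1)` between `χ` and `φ`, so that `φ - χ` solves a
  -- linear equation with bounded potential.
  set q : ℝ → ℝ := fun x =>
    ω - c * ∑ i ∈ Finset.range (p + 1), φ x ^ i * χ x ^ (p + 1 - 1 - i) with hq
  have hφc : Continuous φ := continuous_iff_continuousAt.2 fun x => (hφ x).continuousAt
  have hχc : Continuous χ := continuous_iff_continuousAt.2 fun x => (hχ x).continuousAt
  obtain ⟨C, hC⟩ := bounded_of_periodic hL (f := q) (by fun_prop)
    (fun x => by simp only [hq, hφp x, hχp x])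
  have hs : SolvesHill q (fun x => φ x - χ x) (fun x => φ' x - χ' x) := by
    refine ⟨fun x => (hφ x).sub (hχ x), fun x => ((hφ' x).sub (hχ' x)).congr_deriv ?_⟩
    have := geom_sum₂_mul (φ x) (χ x) (p + 1)
    simp only [hq]
    linear_combination c * this
  have := hs.eq_zero hC (sub_eq_zero.2 h0) (sub_eq_zero.2 h1) x
  exact ⟨sub_eq_zero.1 this.1, sub_eq_zero.1 this.2⟩

lemma profile_eq_zero (hL : 0 < L) {φ φ' : ℝ → ℝ} (hφp : Function.Periodic φ L)
    (hφ : ∀ x, HasDerivAt φ (φ' x) x)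
    (hφ' : ∀ x, HasDerivAt φ' (ω * φ x - c * φ x ^ (p + 1)) x) {x₀ : ℝ}
    (h0 : φ x₀ = 0) (h1 : φ' x₀ = 0) (x : ℝ) : φ x = 0 :=
  (profile_eq_of_eq hL hφp (χ := fun _ => 0) (χ' := fun _ => 0) (fun _ => rfl) hφ hφ'
    (fun x => hasDerivAt_const x 0) (fun x => by simpa using hasDerivAt_const x (0 : ℝ))
    h0 h1 x).1

lemma profile_eq_zero_of_eventuallyEq (hL : 0 < L) {φ φ' : ℝ → ℝ} (hφp : Function.Periodic φ L)
    (hφ : ∀ x, HasDerivAt φ (φ' x) x)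
    (hφ' : ∀ x, HasDerivAt φ' (ω * φ x - c * φ x ^ (p + 1)) x) {x₀ : ℝ}
    (h0 : φ =ᶠ[𝓝 x₀] fun _ => 0) (x : ℝ) : φ x = 0 :=
  profile_eq_zero hL hφp hφ hφ' h0.self_of_nhds
    (by rw [← (hφ x₀).deriv, h0.deriv_eq, deriv_const]) x

/-- A minimizer does not vanish inside the half period. Otherwise, changing its sign between the
two zeros `a` and `L - a` yields a minimizer that violates unique continuation. -/
theorem minimizer_ne_zero (hL : 0 < L) (hω : 0 < ω) (hγ : 0 < γ) (hp : Even p) {ψ : L2per L}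
    (hψ : ψ ∈ Z L p γ) (hmin : IsMinOn (B L ω) (Z L p γ) ψ) {Ψ Ψ' : ℝ → ℝ}
    (hψΨ : ψ =ᵐ[volume.restrict (Ioc 0 L)] Ψ) (hΨp : Function.Periodic Ψ L)
    (hΨo : Function.Odd Ψ) (hΨ : ∀ x, HasDerivAt Ψ (Ψ' x) x)
    (hΨ' : ∀ x, HasDerivAt Ψ' (ω * Ψ x - 2 * B L ω ψ / γ * Ψ x ^ (p + 1)) x)
    {a : ℝ} (ha : a ∈ Ioo 0 (L / 2)) : Ψ a ≠ 0 := by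
  intro ha0
  obtain ⟨ha1, ha2⟩ := ha
  have hΨc : Continuous Ψ := continuous_iff_continuousAt.2 fun x => (hΨ x).continuousAt
  have hΨ'c : Continuous Ψ' := continuous_iff_continuousAt.2 fun x => (hΨ' x).continuousAt
  have hrefl : ∀ x, Ψ (L - x) = - Ψ x := fun x => by
    rw [← hΨo x, ← hΨp (-x)]; congr 1; ring
  have hLa0 : Ψ (L - a) = 0 := by rw [hrefl, ha0, neg_zero]
  -- The flipped function is continuous since `Ψ` vanishes at both ends. The half-open interval
  -- makes `U'` its right derivative at every point, including `a` and `L - a`.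
  let U : ℝ → ℝ := fun x => if x ∈ Ico a (L - a) then - Ψ x else Ψ x
  let U' : ℝ → ℝ := fun x => if x ∈ Ico a (L - a) then - Ψ' x else Ψ' x
  have hUsq : ∀ x, U x ^ 2 = Ψ x ^ 2 := fun x => by
    by_cases h : x ∈ Ico a (L - a) <;> simp only [U, h, if_true, if_false, neg_sq]
  have hU'sq : ∀ x, U' x ^ 2 = Ψ' x ^ 2 := fun x => by
    by_cases h : x ∈ Ico a (L - a) <;> simp only [U', h, if_true, if_false, neg_sq]
  have hUc : Continuous U := by
    refine Continuous.if (fun x hx => ?_) hΨc.neg hΨc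
    have hx' : x ∈ frontier (Ico a (L - a)) := hx
    rw [frontier_Ico (by linarith)] at hx'
    rcases hx' with rfl | rfl
    · rw [ha0, neg_zero]
    · rw [hLa0, neg_zero]
  have hUd : ∀ x, HasDerivWithinAt U (U' x) (Ioi x) x := by
    intro x
    have hout : ∀ s ∈ 𝓝[>] x, (∀ y ∈ s, y ∉ Ico a (L - a)) → x ∉ Ico a (L - a) →
        HasDerivWithinAt U (U' x) (Ioi x) x := by
      intro s hs h1 h2
      simp only [U', if_neg h2]
      refine (hΨ x).hasDerivWithinAt.congr_of_eventuallyEq ?_ (by simp only [U, if_neg h2])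
      filter_upwards [hs] with y hy
      simp only [U, if_neg (h1 y hy)]
    by_cases h1 : x < a
    · refine hout (Ioo x a) (Ioo_mem_nhdsGT h1) (fun y hy h => ?_) (fun h => ?_)
      · exact absurd h.1 (not_le.2 hy.2)
      · exact absurd h.1 (not_le.2 h1)
    by_cases h2 : x < L - a
    · have hx : x ∈ Ico a (L - a) := ⟨not_lt.1 h1, h2⟩
      simp only [U', if_pos hx]
      refine (hΨ x).neg.hasDerivWithinAt.congr_of_eventuallyEq ?_ (by simp only [U, if_pos hx, Pi.neg_apply])
      filter_upwards [Ioo_mem_nhdsGT h2] with y hy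
      simp only [U, if_pos (show y ∈ Ico a (L - a) from ⟨hx.1.trans hy.1.le, hy.2⟩), Pi.neg_apply]
    · refine hout (Ioi x) self_mem_nhdsWithin (fun y hy h => ?_) (fun h => h2 h.2)
      exact h2 (lt_trans hy h.2)
  obtain ⟨W, hW⟩ := exists_rep_of_continuous (L := L) hUc
  have hU'm : MemLp U' 2 (volume.restrict (Ioc 0 L)) := by
    obtain ⟨M, hM⟩ := (isCompact_Icc (a := (0 : ℝ)) (b := L)).exists_bound_of_continuousOn
      hΨ'c.continuousOn
    refine memLp_of_bounded (M := M)
      (Measurable.ite measurableSet_Ico hΨ'c.neg.measurable hΨ'c.measurable).aestronglyMeasurable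
      fun x hx => ?_
    rw [(sq_eq_sq_iff_abs_eq_abs _ _).1 (hU'sq x)]
    exact hM x (Ioc_subset_Icc_self hx)
  let V : L2per L := hU'm.toLp U'
  have hV : V =ᵐ[volume.restrict (Ioc 0 L)] U' := MemLp.coeFn_toLp _
  have hUL : U L = U 0 := by
    have h1 : L ∉ Ico a (L - a) := fun h => by linarith [h.2]
    have h2 : (0 : ℝ) ∉ Ico a (L - a) := fun h => by linarith [h.1]
    simp only [U, if_neg h1, if_neg h2]
    simpa using hΨp 0
  have hWV : IsWeakDeriv W V :=
    isWeakDeriv_of_hasDeriv_right hL hUc.continuousOn hUL (fun x _ => hUd x) hW hV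
  have hUo : ∀ x, U (L - x) = - U x := by
    intro x
    by_cases h : x ∈ Ico a (L - a)
    · by_cases h' : L - x ∈ Ico a (L - a)
      · simp only [U, if_pos h, if_pos h', hrefl]
      · have : x = a := by
          by_contra hne
          exact h' ⟨by linarith [h.2], by linarith [lt_of_le_of_ne h.1 (Ne.symm hne)]⟩
        simp only [U, if_pos h, if_neg h', hrefl]
        simp [this, ha0]
    · by_cases h' : L - x ∈ Ico a (L - a)
      · have : x = L - a := by
          by_contra hne
          refine h ⟨by linarith [h'.2], lt_of_le_of_ne (by linarith [h'.1]) hne⟩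
        simp only [U, if_neg h, if_pos h']
        simp [hrefl, this, ha0]
      · simp only [U, if_neg h, if_neg h', hrefl]
  have hWo : IsOddPer W := by
    filter_upwards [hW, ae_reflect hW] with x h1 h2
    rw [h1, h2, hUo]
  have hp2 : Even (p + 2) := hp.add even_two
  have hWZ : W ∈ Z L p γ := by
    refine ⟨⟨V, hWV⟩, hWo, ?_⟩
    rw [← hψ.2.2]
    refine integral_congr_ae ?_
    filter_upwards [hW, hψΨ] with x h1 h2
    rw [h1, h2]
    obtain ⟨k, hk⟩ := hp2
    rw [hk, ← two_mul, pow_mul, pow_mul, hUsq]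
  obtain ⟨D, hD⟩ := exists_rep_of_continuous (L := L) hΨ'c
  have hψD : IsWeakDeriv ψ D := isWeakDeriv_of_hasDerivAt hL hΨ hΨp hψΨ hD
  have hBW : B L ω W = B L ω ψ := by
    rw [B_eq hL hWV hW hV, B_eq hL hψD hψΨ hD]
    simp only [hUsq, hU'sq]
  have hWmin : IsMinOn (B L ω) (Z L p γ) W := fun u hu => by
    simpa only [mem_ofPred_eq, hBW] using hmin hu
  -- The flipped minimizer solves the equation with the same multiplier, because its energy is the
  -- same.
  obtain ⟨X, X', hWX, hXp, -, hX, -, hX'⟩ := exists_profile hL hω hγ hp hWZ hWmin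
  rw [hBW] at hX'
  have hXc : Continuous X := continuous_iff_continuousAt.2 fun x => (hX x).continuousAt
  have hXU : EqOn X U (Ioc 0 L) := Measure.eqOn_of_ae_eq (hWX.symm.trans hW)
    hXc.continuousOn hUc.continuousOn (by
      rw [interior_Ioc, closure_Ioo hL.ne]; exact Ioc_subset_Icc_self)
  have hleft : X =ᶠ[𝓝 (a / 2)] Ψ := by
    filter_upwards [Ioo_mem_nhds (show 0 < a / 2 by linarith) (show a / 2 < a by linarith)]
      with y hy
    rw [hXU ⟨hy.1, by linarith [hy.2]⟩]
    simp only [U, if_neg (show y ∉ Ico a (L - a) from fun h => absurd h.1 (not_le.2 hy.2))]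
  have hXΨ : ∀ x, X x = Ψ x := fun x => (profile_eq_of_eq hL hXp hΨp hX hX' hΨ hΨ'
    hleft.self_of_nhds (by rw [← (hX _).deriv, hleft.deriv_eq, (hΨ _).deriv]) x).1
  -- In the middle `Ψ = X = U = -Ψ`.
  have hzero : Ψ =ᶠ[𝓝 (L / 2)] fun _ => 0 := by
    filter_upwards [Ioo_mem_nhds ha2 (show L / 2 < L - a by linarith)] with y hy
    have h1 := hXU (show y ∈ Ioc 0 L from ⟨ha1.trans hy.1, by linarith [hy.2]⟩)
    rw [hXΨ] at h1
    simp only [U, if_pos (show y ∈ Ico a (L - a) from ⟨hy.1.le, hy.2⟩)] at h1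
    linarith
  have hΨ0 := profile_eq_zero_of_eventuallyEq hL hΨp hΨ hΨ' hzero
  have : ∫ x in Ioc 0 L, ψ x ^ (p + 2) = 0 := by
    refine integral_eq_zero_of_ae ?_
    filter_upwards [hψΨ] with x hx
    rw [hx, hΨ0]; simp
  linarith [hψ.2.2]

/-! ### Symmetries and critical points of the profile. -/

/-- The profile `φ` of an odd wave: an odd `L`-periodic solution of `φ'' = ω φ - φ^(p+1)` which does
not vanish in the interior of the half period. -/
structure IsProfile (L ω : ℝ) (p : ℕ) (φ φ' : ℝ → ℝ) : Prop where
  periodic : Function.Periodic φ L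
  odd : Function.Odd φ
  hasDerivAt : ∀ x, HasDerivAt φ (φ' x) x
  hasDerivAt' : ∀ x, HasDerivAt φ' (ω * φ x - φ x ^ (p + 1)) x
  ne_zero : ∀ x ∈ Ioo 0 (L / 2), φ x ≠ 0

namespace IsProfile

variable {φ φ' : ℝ → ℝ}

lemma continuous (h : IsProfile L ω p φ φ') : Continuous φ :=
  continuous_iff_continuousAt.2 fun x => (h.hasDerivAt x).continuousAt

lemma continuous' (h : IsProfile L ω p φ φ') : Continuous φ' :=
  continuous_iff_continuousAt.2 fun x => (h.hasDerivAt' x).continuousAt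

lemma neg (h : IsProfile L ω p φ φ') (hp : Even p) :
    IsProfile L ω p (fun x => - φ x) (fun x => - φ' x) where
  periodic x := by simp only [h.periodic x]
  odd x := by simp only [h.odd x]
  hasDerivAt x := (h.hasDerivAt x).neg
  hasDerivAt' x := ((h.hasDerivAt' x).neg).congr_deriv (by rw [hp.add_one.neg_pow]; ring)
  ne_zero x hx := neg_ne_zero.2 (h.ne_zero x hx)

lemma periodic' (h : IsProfile L ω p φ φ') : Function.Periodic φ' L := fun x => by
  have h1 := (h.hasDerivAt (x + L)).comp_add_const x L
  have h2 : (fun x => φ (x + L)) = φ := funext h.periodic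
  rw [h2] at h1
  exact h1.unique (h.hasDerivAt x)

lemma even' (h : IsProfile L ω p φ φ') (x : ℝ) : φ' (-x) = φ' x := by
  have h1 := ((h.hasDerivAt (-x)).comp x (hasDerivAt_neg x)).neg
  have h2 : -(φ ∘ Neg.neg) = φ := funext fun y => by simp [h.odd y]
  rw [h2] at h1
  have := h1.unique (h.hasDerivAt x)
  linarith

lemma eq_of_eq (h : IsProfile L ω p φ φ') (hL : 0 < L) {χ χ' : ℝ → ℝ}
    (hχp : Function.Periodic χ L) (hχ : ∀ x, HasDerivAt χ (χ' x) x)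
    (hχ' : ∀ x, HasDerivAt χ' (ω * χ x - χ x ^ (p + 1)) x) {x₀ : ℝ}
    (h0 : φ x₀ = χ x₀) (h1 : φ' x₀ = χ' x₀) (x : ℝ) : φ x = χ x ∧ φ' x = χ' x :=
  profile_eq_of_eq (ω := ω) (c := 1) (p := p) hL h.periodic hχp h.hasDerivAt
    (fun x => by simpa using h.hasDerivAt' x) hχ (fun x => by simpa using hχ' x) h0 h1 x

/-- Uniqueness at the fixed point `b / 2` of the reflection. As `b - b / 2 = b / 2`, the hypotheses
amount to `φ' (b / 2) = 0`: a critical point is an axis of symmetry. -/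
lemma reflect_eq (h : IsProfile L ω p φ φ') (hL : 0 < L) {b : ℝ}
    (h0 : φ (b / 2) = φ (b - b / 2)) (h1 : φ' (b / 2) = - φ' (b - b / 2)) (x : ℝ) :
    φ x = φ (b - x) := by
  have hb : ∀ x, HasDerivAt (fun x : ℝ => b - x) (-1) x := fun x => by
    simpa using (hasDerivAt_id x).const_sub b
  refine (h.eq_of_eq hL (χ := fun x => φ (b - x)) (χ' := fun x => - φ' (b - x)) (fun x => ?_)
    (fun x => ((h.hasDerivAt (b - x)).comp x (hb x)).congr_deriv (by ring))
    (fun x => (((h.hasDerivAt' (b - x)).comp x (hb x)).neg).congr_deriv (by ring)) h0 h1 x).1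
  simp only
  rw [← sub_sub]; exact h.periodic.sub_eq _

lemma zero (h : IsProfile L ω p φ φ') : φ 0 = 0 := by
  have := h.odd 0
  simp only [neg_zero] at this
  linarith

lemma refl_full (h : IsProfile L ω p φ φ') (x : ℝ) : φ (L - x) = - φ x := by
  rw [← h.odd x, ← h.periodic (-x)]; congr 1; ring

lemma half (h : IsProfile L ω p φ φ') : φ (L / 2) = 0 := by
  have := h.refl_full (L / 2)
  rw [sub_half] at this
  linarith

lemma deriv_zero_ne (h : IsProfile L ω p φ φ') (hL : 0 < L) : φ' 0 ≠ 0 := fun h0 =>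
  h.ne_zero (L / 4) ⟨by linarith, by linarith⟩
    (profile_eq_zero (ω := ω) (c := 1) (p := p) hL h.periodic h.hasDerivAt
      (fun x => by simpa using h.hasDerivAt' x) h.zero h0 _)

/-- The profile is symmetric about the quarter period. -/
lemma symm_quarter (h : IsProfile L ω p φ φ') (hL : 0 < L) (x : ℝ) : φ (L / 2 - x) = φ x := by
  -- Conservation of energy between the two zeros `0` and `L / 2` of `φ`.
  have henergy : φ' (L / 2) ^ 2 = φ' 0 ^ 2 := by
    have hE : ∀ x, HasDerivAt
        (fun x => φ' x ^ 2 - ω * φ x ^ 2 + 2 / (p + 2) * φ x ^ (p + 2)) 0 x := by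
      intro x
      refine ((((h.hasDerivAt' x).fun_pow 2).sub (((h.hasDerivAt x).fun_pow 2).const_mul ω)).add
        (((h.hasDerivAt x).fun_pow (p + 2)).const_mul (2 / ((p : ℝ) + 2)))).congr_deriv ?_
      have : (p : ℝ) + 2 ≠ 0 := by positivity
      push_cast
      field_simp
      ring
    have := is_const_of_deriv_eq_zero (fun x => (hE x).differentiableAt)
      (fun x => (hE x).deriv) (L / 2) 0
    simp only [h.half, h.zero] at this
    simpa using this
  rcases sq_eq_sq_iff_eq_or_eq_neg.1 henergy with h1 | h1
  -- Equal slopes would make `φ` periodic with period `L / 2`; then `φ (L/4) = φ (3L/4) = -φ (L/4)`,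
  -- an interior zero.
  · exfalso
    have h2 := (h.eq_of_eq hL (χ := fun x => φ (x + L / 2)) (χ' := fun x => φ' (x + L / 2))
      (fun x => by
        simp only
        rw [add_right_comm]; exact h.periodic _)
      (fun x => (h.hasDerivAt _).comp_add_const x _)
      (fun x => (h.hasDerivAt' _).comp_add_const x _) (x₀ := 0)
      (by simp [h.zero, h.half]) (by simp [h1]) (L / 4)).1
    have h3 := h.refl_full (L / 4)
    have h4 : L / 4 + L / 2 = L - L / 4 := by ring
    simp only [h4, h3] at h2
    exact h.ne_zero (L / 4) ⟨by linarith, by linarith⟩ (by linarith)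
  · have hb : ∀ x, HasDerivAt (fun x : ℝ => L / 2 - x) (-1) x := fun x => by
      simpa using (hasDerivAt_id x).const_sub (L / 2)
    refine ((h.eq_of_eq hL (χ := fun x => φ (L / 2 - x)) (χ' := fun x => - φ' (L / 2 - x))
      (fun x => ?_) (fun x => ((h.hasDerivAt _).comp x (hb x)).congr_deriv (by ring))
      (fun x => (((h.hasDerivAt' _).comp x (hb x)).neg).congr_deriv (by ring)) (x₀ := 0)
      (by simp [h.zero, h.half]) (by simp [h1]) x).1).symm
    simp only
    rw [← sub_sub]; exact h.periodic.sub_eq _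

lemma deriv_symm_quarter (h : IsProfile L ω p φ φ') (hL : 0 < L) (x : ℝ) :
    φ' (L / 2 - x) = - φ' x := by
  have hb : HasDerivAt (fun x : ℝ => L / 2 - x) (-1) x := by
    simpa using (hasDerivAt_id x).const_sub (L / 2)
  have h1 := (h.hasDerivAt (L / 2 - x)).comp x hb
  have h2 : φ ∘ (fun x : ℝ => L / 2 - x) = φ := funext fun y => h.symm_quarter hL y
  rw [h2] at h1
  have := h1.unique (h.hasDerivAt x)
  linarith

lemma deriv_quarter (h : IsProfile L ω p φ φ') (hL : 0 < L) : φ' (L / 4) = 0 := by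
  have := h.deriv_symm_quarter hL (L / 4)
  rw [show L / 2 - L / 4 = L / 4 by ring] at this
  linarith

/-- The only critical point of the profile in the half period is the quarter period. -/
lemma eq_quarter_of_deriv_eq_zero (h : IsProfile L ω p φ φ') (hL : 0 < L) {x : ℝ}
    (hx : x ∈ Icc 0 (L / 2)) (hx0 : φ' x = 0) : x = L / 4 := by
  have hx1 : 0 < x := hx.1.lt_of_ne fun h0 => h.deriv_zero_ne hL (h0 ▸ hx0)
  -- Reflection in the critical point `x` gives `φ (2x) = φ 0 = 0`. The only zeros available for
  -- `2x` are `L / 2` and `L`, and the latter is excluded by the nonzero slope at `L / 2`.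
  have h1 := h.reflect_eq hL (b := 2 * x) (by congr 1; ring)
    (by rw [show 2 * x / 2 = x by ring, show 2 * x - x = x by ring, hx0, neg_zero]) 0
  rw [h.zero, sub_zero] at h1
  rcases lt_trichotomy (2 * x) (L / 2) with h2 | h2 | h2
  · exact absurd h1.symm (h.ne_zero _ ⟨by linarith, h2⟩)
  · linarith
  · rcases hx.2.eq_or_lt with h3 | h3
    · exfalso
      have h4 := h.deriv_symm_quarter hL 0
      rw [sub_zero, ← h3, hx0] at h4
      exact h.deriv_zero_ne hL (by linarith)
    · have h4 := h.refl_full (2 * x)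
      rw [← h1, neg_zero] at h4
      exact absurd h4 (h.ne_zero _ ⟨by linarith, by linarith⟩)

/-- This nodal interval of `φ'` and the next one cover a period; Jacobi's inequality is applied on
each. -/
lemma deriv_ne_zero_left (h : IsProfile L ω p φ φ') (hL : 0 < L) :
    ∀ x ∈ Ioo (-(L / 4)) (L / 4), φ' x ≠ 0 := by
  intro x hx h0
  rcases le_total 0 x with h1 | h1
  · have := h.eq_quarter_of_deriv_eq_zero hL ⟨h1, by linarith [hx.2]⟩ h0
    linarith [hx.2]
  · have := h.eq_quarter_of_deriv_eq_zero hL (x := -x) ⟨by linarith, by linarith [hx.1]⟩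
      (by rw [h.even', h0])
    linarith [hx.1]

lemma deriv_ne_zero_right (h : IsProfile L ω p φ φ') (hL : 0 < L) :
    ∀ x ∈ Ioo (L / 4) (3 * L / 4), φ' x ≠ 0 := by
  intro x hx h0
  refine h.deriv_ne_zero_left hL (L / 2 - x) ⟨by linarith [hx.2], by linarith [hx.1]⟩ ?_
  rw [h.deriv_symm_quarter hL, h0, neg_zero]

end IsProfile

/-! ### Shooting from the quarter period: the two negative eigenvalues. -/

lemma SolvesHill.translate {q u w : ℝ → ℝ} (h : SolvesHill q u w) (b : ℝ) :
    SolvesHill (fun x => q (x + b)) (fun x => u (x + b)) (fun x => w (x + b)) :=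
  ⟨fun x => (h.1 (x + b)).comp_add_const x b, fun x => (h.2 (x + b)).comp_add_const x b⟩

lemma SolvesHill.periodic_right {q u w : ℝ → ℝ} (h : SolvesHill q u w)
    (hu : Function.Periodic u L) : Function.Periodic w L := fun x => by
  have h1 := (h.1 (x + L)).comp_add_const x L
  have h2 : (fun x => u (x + L)) = u := funext hu
  rw [h2] at h1
  exact h1.unique (h.1 x)

/-- Below the bottom of the potential, the solution with a critical point at `b` is convex. -/
lemma SolvesHill.pos_neg_of_pos {q u w : ℝ → ℝ} (h : SolvesHill q u w) (hq : ∀ x, 0 < q x)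
    {a b : ℝ} (hab : a < b) (hu : u b = 1) (hw : w b = 0) : 0 < u a ∧ w a < 0 := by
  -- The product `u w` increases and vanishes at `b`, so `u²` decreases up to `b` and stays at least
  -- `1` there. Hence `u` keeps its sign, and `w` is strictly increasing.
  have huw : ∀ x, HasDerivAt (fun x => u x * w x) (w x ^ 2 + q x * u x ^ 2) x := fun x =>
    ((h.1 x).mul (h.2 x)).congr_deriv (by ring)
  have hmono : Monotone fun x => u x * w x := monotone_of_deriv_nonneg
    (fun x => (huw x).differentiableAt) fun x => by
      rw [(huw x).deriv]
      have := (hq x).le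
      positivity
  have husq : ∀ x, HasDerivAt (fun x => u x ^ 2) (2 * (u x * w x)) x := fun x =>
    ((h.1 x).fun_pow 2).congr_deriv (by simp; ring)
  have hanti : AntitoneOn (fun x => u x ^ 2) (Iic b) :=
    antitoneOn_of_deriv_nonpos (convex_Iic b)
      (fun x _ => (husq x).continuousAt.continuousWithinAt)
      (fun x _ => (husq x).differentiableAt.differentiableWithinAt) fun x hx => by
        rw [interior_Iic] at hx
        rw [(husq x).deriv]
        have := hmono (le_of_lt hx)
        simp only [hw, mul_zero] at this
        linarith
  have hne : ∀ x ∈ Iic b, u x ≠ 0 := fun x hx h0 => by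
    have := hanti hx (mem_Iic.2 le_rfl) hx
    simp only [hu, h0] at this
    norm_num at this
  have hpos : ∀ x ∈ Iic b, 0 < u x := fun x hx => by
    by_contra hx0
    obtain ⟨y, hy, hy0⟩ := intermediate_value_Icc (mem_Iic.1 hx) h.continuous_left.continuousOn
      (show (0 : ℝ) ∈ Icc (u x) (u b) from ⟨not_lt.1 hx0, by rw [hu]; exact zero_le_one⟩)
    exact hne y hy.2 hy0
  refine ⟨hpos a hab.le, ?_⟩
  have hsm : StrictMonoOn w (Iic b) := strictMonoOn_of_deriv_pos (convex_Iic b)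
    h.continuous_right.continuousOn fun x hx => by
      rw [interior_Iic] at hx
      rw [(h.2 x).deriv]
      exact mul_pos (hq x) (hpos x (Iio_subset_Iic_self hx))
  have := hsm (mem_Iic.2 hab.le) (mem_Iic.2 le_rfl) hab
  rwa [hw] at this

/-- The potential of the linearized operator. -/
def potential (ω : ℝ) (p : ℕ) (φ : ℝ → ℝ) (x : ℝ) : ℝ := ω - (p + 1) * φ x ^ p

namespace IsProfile

variable {φ φ' : ℝ → ℝ}

lemma continuous_potential (h : IsProfile L ω p φ φ') : Continuous (potential ω p φ) := by
  have := h.continuous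
  unfold potential
  fun_prop

lemma periodic_potential (h : IsProfile L ω p φ φ') : Function.Periodic (potential ω p φ) L :=
  fun x => by simp only [potential, h.periodic x]

lemma potential_neg (h : IsProfile L ω p φ φ') (hp : Even p) (x : ℝ) :
    potential ω p φ (-x) = potential ω p φ x := by
  simp only [potential, h.odd x, hp.neg_pow]

lemma potential_symm_quarter (h : IsProfile L ω p φ φ') (hL : 0 < L) (x : ℝ) :
    potential ω p φ (L / 2 - x) = potential ω p φ x := by
  simp only [potential, h.symm_quarter hL]

lemma exists_bound_potential (h : IsProfile L ω p φ φ') (hL : 0 < L) :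
    ∃ C, ∀ x, |potential ω p φ x| ≤ C :=
  bounded_of_periodic hL h.continuous_potential h.periodic_potential

lemma exists_bound_potential_sub (h : IsProfile L ω p φ φ') (hL : 0 < L) (μ : ℝ) :
    ∃ C, ∀ x, |potential ω p φ x - μ| ≤ C :=
  bounded_of_periodic hL (h.continuous_potential.sub continuous_const)
    fun x => by simp only [h.periodic_potential x]

/-- The derivative of the profile is in the kernel of the linearized operator. -/
lemma solvesHill_deriv (h : IsProfile L ω p φ φ') :
    SolvesHill (potential ω p φ) φ' (fun x => ω * φ x - φ x ^ (p + 1)) := by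
  refine ⟨h.hasDerivAt', fun x => ?_⟩
  refine (((h.hasDerivAt x).const_mul ω).sub ((h.hasDerivAt x).fun_pow (p + 1))).congr_deriv ?_
  simp only [potential]
  push_cast
  ring

/-- A comparison equation: its potential exceeds that of `𝓛` by `p φ^p`, which has a sign because
`p` is positive and `φ` is positive on the half period. -/
lemma solvesHill_self (h : IsProfile L ω p φ φ') :
    SolvesHill (fun x => ω - φ x ^ p) φ φ' :=
  ⟨h.hasDerivAt, fun x => (h.hasDerivAt' x).congr_deriv (by rw [pow_succ]; ring)⟩

/-- Otherwise `φ'` would have zero Cauchy data at `L / 4` and vanish identically. -/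
lemma second_deriv_quarter_ne (h : IsProfile L ω p φ φ') (hL : 0 < L) :
    ω * φ (L / 4) - φ (L / 4) ^ (p + 1) ≠ 0 := fun h0 => by
  obtain ⟨C, hC⟩ := h.exists_bound_potential hL
  exact h.deriv_zero_ne hL (h.solvesHill_deriv.eq_zero hC (h.deriv_quarter hL) h0 0).1

/-- Signs of the solution at energy zero with a critical point at the quarter period. -/
lemma neg_pos_of_critical (h : IsProfile L ω p φ φ') (hL : 0 < L) (hp0 : 0 < p)
    (hpos : ∀ x ∈ Ioo 0 (L / 2), 0 < φ x) {u w : ℝ → ℝ}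
    (hu : SolvesHill (potential ω p φ) u w) (hu1 : u (L / 4) = 1) (hw1 : w (L / 4) = 0) :
    u 0 < 0 ∧ 0 < w 0 := by
  have hL4 : 0 < L / 4 := by linarith
  have hφ'0 : 0 < φ' 0 := by
    refine lt_of_le_of_ne ?_ (h.deriv_zero_ne hL).symm
    have h1 : HasDerivWithinAt φ (φ' 0) (Ioi 0) 0 := (h.hasDerivAt 0).hasDerivWithinAt
    rw [hasDerivWithinAt_iff_tendsto_slope' (by simp)] at h1
    refine ge_of_tendsto h1 ?_
    filter_upwards [Ioo_mem_nhdsGT (show (0 : ℝ) < L / 2 by linarith)] with x hx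
    rw [slope_def_field, h.zero, sub_zero, sub_zero]
    exact (div_pos (hpos x hx) hx.1).le
  have hφ'pos : ∀ x ∈ Ico 0 (L / 4), 0 < φ' x := fun x hx => by
    by_contra hx0
    obtain ⟨y, hy, hy0⟩ := intermediate_value_Icc' hx.1 h.continuous'.continuousOn
      (show (0 : ℝ) ∈ Icc (φ' x) (φ' 0) from ⟨not_lt.1 hx0, hφ'0.le⟩)
    exact h.deriv_ne_zero_left hL y ⟨by linarith [hy.1], by linarith [hy.2, hx.2]⟩ hy0
  have hφ''neg : ω * φ (L / 4) - φ (L / 4) ^ (p + 1) < 0 := by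
    refine lt_of_le_of_ne ?_ (h.second_deriv_quarter_ne hL)
    have h1 : HasDerivWithinAt φ' (ω * φ (L / 4) - φ (L / 4) ^ (p + 1)) (Iio (L / 4)) (L / 4) :=
      (h.hasDerivAt' (L / 4)).hasDerivWithinAt
    rw [hasDerivWithinAt_iff_tendsto_slope' (by simp)] at h1
    refine le_of_tendsto h1 ?_
    filter_upwards [Ioo_mem_nhdsLT hL4] with x hx
    rw [slope_def_field, h.deriv_quarter hL, sub_zero]
    exact (div_neg_of_pos_of_neg (hφ'pos x ⟨hx.1.le, hx.2⟩) (by linarith [hx.2])).le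
  -- The Wronskian of `u` and `φ'` is the constant `-φ''(L/4) > 0`.
  have hW := fun x => hu.wronskian_eq h.solvesHill_deriv x (L / 4)
  simp only [hu1, hw1, zero_mul, one_mul, zero_sub] at hW
  constructor
  · by_contra hu0
    rw [not_lt] at hu0
    -- If `u 0 ≥ 0`, the positive Wronskian makes `u / φ'` increase, so `u > 0` on `(0, L/4)`. The
    -- Wronskian with `φ` would then be strictly decreasing, although it goes from `-u(0) φ'(0) ≤ 0`
    -- to `0`.
    have hquot : StrictMonoOn (fun x => u x / φ' x) (Ico 0 (L / 4)) := by
      have hd : ∀ x ∈ Ico 0 (L / 4), HasDerivAt (fun x => u x / φ' x)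
          (-(ω * φ (L / 4) - φ (L / 4) ^ (p + 1)) / φ' x ^ 2) x := fun x hx => by
        rw [← hW x]
        exact (hu.1 x).div (h.hasDerivAt' x) (hφ'pos x hx).ne'
      refine strictMonoOn_of_deriv_pos (convex_Ico _ _)
        (fun x hx => (hd x hx).continuousAt.continuousWithinAt) fun x hx => ?_
      rw [interior_Ico] at hx
      rw [(hd x ⟨hx.1.le, hx.2⟩).deriv]
      have := hφ'pos x ⟨hx.1.le, hx.2⟩
      exact div_pos (by linarith) (by positivity)
    have hupos : ∀ x ∈ Ioo 0 (L / 4), 0 < u x := fun x hx => by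
      have h1 := hquot ⟨le_rfl, hL4⟩ ⟨hx.1.le, hx.2⟩ hx.1
      simp only at h1
      have h2 : 0 < u x / φ' x := lt_of_le_of_lt (div_nonneg hu0 hφ'0.le) h1
      exact (div_pos_iff_of_pos_right (hφ'pos x ⟨hx.1.le, hx.2⟩)).1 h2
    have hD := fun x => hu.hasDerivAt_wronskian h.solvesHill_self x
    have hanti : StrictAntiOn (fun x => w x * φ x - u x * φ' x) (Icc 0 (L / 4)) := by
      refine strictAntiOn_of_deriv_neg (convex_Icc _ _)
        (fun x _ => (hD x).continuousAt.continuousWithinAt) fun x hx => ?_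
      rw [interior_Icc] at hx
      rw [(hD x).deriv]
      have h1 := hupos x hx
      have h2 := hpos x ⟨hx.1, by linarith [hx.2]⟩
      have h3 : potential ω p φ x - (ω - φ x ^ p) = -(p * φ x ^ p) := by
        rw [potential]; ring
      have h4 : (0 : ℝ) < p := by exact_mod_cast hp0
      rw [h3, neg_mul]
      exact neg_neg_of_pos (by positivity)
    have := hanti ⟨le_rfl, hL4.le⟩ ⟨hL4.le, le_rfl⟩ hL4
    simp only [h.zero, h.deriv_quarter hL, hw1] at this
    have h5 := mul_nonneg hu0 hφ'0.le
    linarith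
  -- Since `φ''(0) = 0`, the constant Wronskian at `0` is just `w 0 * φ' 0`.
  · have h0 := hW 0
    simp only [h.zero, mul_zero, zero_pow (Nat.succ_ne_zero p), sub_zero] at h0
    exact (pos_iff_pos_of_mul_pos (by rw [h0]; linarith)).2 hφ'0

end IsProfile

/-- A periodic eigenfunction of `-∂² + q`. -/
structure IsEigenpair (L : ℝ) (q : ℝ → ℝ) (μ : ℝ) (u w : ℝ → ℝ) : Prop where
  solves : SolvesHill (fun x => q x - μ) u w
  periodic : Function.Periodic u L

/-- The linearized operator has two negative eigenvalues, with an even and an odd eigenfunction. -/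
theorem IsProfile.exists_negative_eigenpairs {φ φ' : ℝ → ℝ} (h : IsProfile L ω p φ φ')
    (hL : 0 < L) (hp : Even p) (hp0 : 0 < p) :
    ∃ (μ₀ μ₁ : ℝ) (u₀ w₀ u₁ w₁ : ℝ → ℝ), μ₀ < 0 ∧ μ₁ < 0 ∧ μ₀ ≠ μ₁ ∧
      IsEigenpair L (potential ω p φ) μ₀ u₀ w₀ ∧ IsEigenpair L (potential ω p φ) μ₁ u₁ w₁ ∧
      u₀ (L / 4) = 1 ∧ u₀ (-(L / 4)) = 1 ∧ u₁ (L / 4) = 1 ∧ u₁ (-(L / 4)) = -1 := by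
  wlog hpos : ∀ x ∈ Ioo 0 (L / 2), 0 < φ x generalizing φ φ'
  · have hneg : ∀ x ∈ Ioo 0 (L / 2), 0 < - φ x := by
      push Not at hpos
      obtain ⟨y, hy, hy0⟩ := hpos
      intro x hx
      by_contra hx0
      obtain ⟨z, hz, hz0⟩ := (isPreconnected_Ioo (a := 0) (b := L / 2)).intermediate_value hy hx
        h.continuous.continuousOn (show (0 : ℝ) ∈ Icc (φ y) (φ x) from ⟨hy0, by linarith⟩)
      exact h.ne_zero z hz hz0
    have := this (h.neg hp) hneg
    have hV : potential ω p (fun x => - φ x) = potential ω p φ := by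
      funext x; simp only [potential, hp.neg_pow]
    rwa [hV] at this
  set V := potential ω p φ with hVdef
  -- The potential is translated so that the data `(1, 0)`, prescribed at `0`, end up at `L / 4`.
  obtain ⟨u, w, hs, hu0, hw0, hcont⟩ := exists_solvesHill_family
    (h.continuous_potential.comp (continuous_id.add continuous_const) :
      Continuous fun x => potential ω p φ (x + L / 4))
  set U : ℝ → ℝ → ℝ := fun μ x => u μ (x + -(L / 4)) with hU
  set W : ℝ → ℝ → ℝ := fun μ x => w μ (x + -(L / 4)) with hW
  have hS : ∀ μ, SolvesHill (fun x => V x - μ) (U μ) (W μ) := fun μ => by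
    have := (hs μ).translate (-(L / 4))
    simpa using this
  have hU1 : ∀ μ, U μ (L / 4) = 1 := fun μ => by simp [hU, hu0]
  have hW1 : ∀ μ, W μ (L / 4) = 0 := fun μ => by simp [hW, hw0]
  have hUc : Continuous fun μ => U μ 0 := (hcont _).1
  have hWc : Continuous fun μ => W μ 0 := (hcont _).2
  obtain ⟨C, hC⟩ := h.exists_bound_potential hL
  have hC0 : 0 ≤ C := (abs_nonneg _).trans (hC 0)
  -- At `μ = -(C + 1)` the shifted potential `V - μ` is at least `1`.
  have hlow := (hS (-(C + 1))).pos_neg_of_pos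
    (fun x => by have := (abs_le.1 (hC x)).1; simp only [hVdef]; linarith)
    (show 0 < L / 4 by linarith) (hU1 _) (hW1 _)
  have hzero := h.neg_pos_of_critical hL hp0 hpos (u := U 0) (w := W 0)
    (by simpa using hS 0) (hU1 0) (hW1 0)
  obtain ⟨μ₀, hμ₀, hμ₀0⟩ := intermediate_value_Ioo (show -(C + 1) ≤ 0 by linarith)
    hWc.continuousOn (show (0 : ℝ) ∈ Ioo (W (-(C + 1)) 0) (W 0 0) from ⟨hlow.2, hzero.2⟩)
  obtain ⟨μ₁, hμ₁, hμ₁0⟩ := intermediate_value_Ioo' (show -(C + 1) ≤ 0 by linarith)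
    hUc.continuousOn (show (0 : ℝ) ∈ Ioo (U 0 0) (U (-(C + 1)) 0) from ⟨hzero.1, hlow.1⟩)
  have hsymm : ∀ μ x, U μ (L / 2 - x) = U μ x := fun μ x => by
    obtain ⟨K, hK⟩ := h.exists_bound_potential_sub hL μ
    refine (((hS μ).reflect (b := L / 2) (fun x => ?_)).eq_of_eq (hS μ) hK (x₀ := L / 4)
      ?_ ?_ x).1
    · simp only [hVdef, h.potential_symm_quarter hL]
    · rw [show L / 2 - L / 4 = L / 4 by ring]
    · rw [show L / 2 - L / 4 = L / 4 by ring, hW1, neg_zero]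
  have hrefl : ∀ μ, SolvesHill (fun x => V x - μ) (fun x => U μ (0 - x)) (fun x => - W μ (0 - x)) :=
    fun μ => (hS μ).reflect fun x => by simp only [zero_sub, hVdef, h.potential_neg hp]
  have heven : ∀ x, U μ₀ (-x) = U μ₀ x := fun x => by
    obtain ⟨K, hK⟩ := h.exists_bound_potential_sub hL μ₀
    have := ((hrefl μ₀).eq_of_eq (hS μ₀) hK (x₀ := 0) (by simp) (by simp [hμ₀0]) x).1
    simpa using this
  have hodd : ∀ x, U μ₁ (-x) = - U μ₁ x := fun x => by
    obtain ⟨K, hK⟩ := h.exists_bound_potential_sub hL μ₁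
    have := ((hrefl μ₁).eq_of_eq ((hS μ₁).const_mul (-1)) hK (x₀ := 0) (by simp [hμ₁0])
      (by simp) x).1
    simpa using this
  -- Symmetry about `L / 4` combined with evenness gives period `L / 2`; combined with oddness, it
  -- gives antiperiod `L / 2`. In both cases `L` is a period.
  have hper0 : Function.Periodic (U μ₀) L := fun x => by
    have h1 : ∀ y, U μ₀ (y + L / 2) = U μ₀ y := fun y => by
      rw [← heven y, ← hsymm μ₀ (-y)]; congr 1; ring
    rw [← h1 x, ← h1 (x + L / 2)]; congr 1; ring
  have hper1 : Function.Periodic (U μ₁) L := fun x => by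
    have h1 : ∀ y, U μ₁ (y + L / 2) = - U μ₁ y := fun y => by
      rw [← hodd y, ← hsymm μ₁ (-y)]; congr 1; ring
    rw [← neg_neg (U μ₁ x), ← h1 x, ← h1 (x + L / 2)]; congr 1; ring
  refine ⟨μ₀, μ₁, U μ₀, W μ₀, U μ₁, W μ₁, hμ₀.2, hμ₁.2, ?_, ⟨hS μ₀, hper0⟩, ⟨hS μ₁, hper1⟩,
    hU1 _, by rw [heven, hU1], hU1 _, by rw [hodd, hU1]⟩
  -- If the eigenvalues coincided, value and slope at `0` would both vanish.
  intro heq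
  obtain ⟨K, hK⟩ := h.exists_bound_potential_sub hL μ₀
  have := ((hS μ₀).eq_zero hK (x₀ := 0) (by rw [heq]; exact hμ₁0) hμ₀0 (L / 4)).1
  rw [hU1] at this
  exact one_ne_zero this

/-! ### The quadratic form, the kernel and the negative spectrum. -/

lemma integral_deriv_eq_zero_of_periodic {F f : ℝ → ℝ} (hF : ∀ x, HasDerivAt F (f x) x)
    (hf : Continuous f) (hp : Function.Periodic F L) : ∫ x in (0 : ℝ)..L, f x = 0 := by
  rw [intervalIntegral.integral_eq_sub_of_hasDerivAt (fun x _ => hF x)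
    (hf.intervalIntegrable _ _), sub_eq_zero]
  simpa using hp 0

namespace IsEigenpair

variable {q u w u' w' : ℝ → ℝ} {μ ν : ℝ}

lemma periodic_right (h : IsEigenpair L q μ u w) : Function.Periodic w L :=
  h.solves.periodic_right h.periodic

lemma continuous (h : IsEigenpair L q μ u w) : Continuous u := h.solves.continuous_left

lemma continuous_right (h : IsEigenpair L q μ u w) : Continuous w := h.solves.continuous_right

lemma sub_const_mul (h : IsEigenpair L q μ u w) (h' : IsEigenpair L q μ u' w') (c : ℝ) :
    IsEigenpair L q μ (fun x => u x - c * u' x) (fun x => w x - c * w' x) :=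
  ⟨h.solves.sub (h'.solves.const_mul c), fun x => by simp only [h.periodic x, h'.periodic x]⟩

/-- Eigenfunctions with different eigenvalues are orthogonal. -/
lemma orthogonal (h : IsEigenpair L q μ u w) (h' : IsEigenpair L q ν u' w') (hne : μ ≠ ν) :
    ∫ x in (0 : ℝ)..L, u x * u' x = 0 := by
  have hc := h.continuous
  have hc' := h'.continuous
  have h1 : ∫ x in (0 : ℝ)..L, (ν - μ) * (u x * u' x) = 0 :=
    integral_deriv_eq_zero_of_periodic
      (fun x => (h.solves.hasDerivAt_wronskian h'.solves x).congr_deriv (by ring))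
      (by fun_prop) (fun x => by
        simp only [h.periodic x, h'.periodic x, h.periodic_right x, h'.periodic_right x])
  rw [intervalIntegral.integral_const_mul] at h1
  exact (mul_eq_zero.1 h1).resolve_left (sub_ne_zero.2 hne.symm)

lemma eq_zero_of_integral_sq (hL : 0 < L) (h : IsEigenpair L q μ u w)
    (h0 : ∫ x in (0 : ℝ)..L, u x * u x = 0) (x : ℝ) : u x = 0 := by
  have hc := h.continuous
  rw [← integral_Ioc_eq hL, integral_eq_zero_iff_of_nonneg (fun x => mul_self_nonneg _)
    ((by fun_prop : Continuous fun x => u x * u x).integrableOn_Icc.mono_set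
      Ioc_subset_Icc_self)] at h0
  refine eq_of_ae_eq_of_periodic hL hc continuous_const h.periodic (fun _ => rfl) ?_ x
  filter_upwards [h0] with y hy
  exact mul_self_eq_zero.1 hy

lemma integral_sq_pos (hL : 0 < L) (h : IsEigenpair L q μ u w) {x : ℝ} (hx : u x ≠ 0) :
    0 < ∫ x in (0 : ℝ)..L, u x * u x :=
  (intervalIntegral.integral_nonneg hL.le fun _ _ => mul_self_nonneg _).lt_of_ne' fun h0 =>
    hx (h.eq_zero_of_integral_sq hL h0 x)

end IsEigenpair

namespace IsProfile

variable {φ φ' : ℝ → ℝ}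

/-- The quadratic form of the linearized operator is nonnegative on the periodic functions that
vanish at the critical points of the profile. -/
lemma quadratic_nonneg (h : IsProfile L ω p φ φ') (hL : 0 < L) {v v' : ℝ → ℝ}
    (hv : ∀ x, HasDerivAt v (v' x) x) (hv'c : Continuous v') (hvp : Function.Periodic v L)
    (hv'p : Function.Periodic v' L) (h1 : v (L / 4) = 0) (h2 : v (-(L / 4)) = 0) :
    0 ≤ ∫ x in (0 : ℝ)..L, (v' x ^ 2 + potential ω p φ x * v x ^ 2) := by
  have hvc : Continuous v := continuous_iff_continuousAt.2 fun x => (hv x).continuousAt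
  have hVc := h.continuous_potential
  have hper : Function.Periodic (fun x => v' x ^ 2 + potential ω p φ x * v x ^ 2) L := fun x => by
    simp only [hvp x, hv'p x, h.periodic_potential x]
  have hint : ∀ a b : ℝ, IntervalIntegrable
      (fun x => v' x ^ 2 + potential ω p φ x * v x ^ 2) volume a b := fun a b =>
    (by fun_prop : Continuous fun x => v' x ^ 2 + potential ω p φ x * v x ^ 2).intervalIntegrable
      a b
  -- The period is moved to `[-L/4, 3L/4]` and cut at `L / 4`, into the two nodal intervals of `φ'`.
  have e := hper.intervalIntegral_add_eq 0 (-(L / 4))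
  rw [zero_add, show -(L / 4) + L = 3 * L / 4 by ring] at e
  rw [e, ← intervalIntegral.integral_add_adjacent_intervals (hint _ (L / 4)) (hint _ _)]
  have hq := h.second_deriv_quarter_ne hL
  have hqm : ω * φ (-(L / 4)) - φ (-(L / 4)) ^ (p + 1) ≠ 0 := fun h0 => by
    obtain ⟨C, hC⟩ := h.exists_bound_potential hL
    exact h.deriv_zero_ne hL (h.solvesHill_deriv.eq_zero hC (x₀ := -(L / 4))
      (by rw [h.even', h.deriv_quarter hL]) h0 0).1
  have h34 : 3 * L / 4 = -(L / 4) + L := by ring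
  have hφ34 : φ (3 * L / 4) = φ (-(L / 4)) := by rw [h34, h.periodic]
  refine add_nonneg ?_ ?_
  · exact h.solvesHill_deriv.jacobi hVc (by linarith) (h.deriv_ne_zero_left hL)
      (by rw [h.even', h.deriv_quarter hL]) (h.deriv_quarter hL) hqm hq hv hv'c h2 h1
  · exact h.solvesHill_deriv.jacobi hVc (by linarith) (h.deriv_ne_zero_right hL)
      (h.deriv_quarter hL) (by rw [h34, h.periodic', h.even', h.deriv_quarter hL]) hq
      (by rw [hφ34]; exact hqm) hv hv'c h1 (by rw [h34, hvp, h2])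

/-- The spectral inequality for an eigenfunction orthogonal to the two negative ones. -/
lemma spectral_inequality (h : IsProfile L ω p φ φ') (hL : 0 < L) {μ₀ μ₁ μ : ℝ}
    {u₀ w₀ u₁ w₁ u w : ℝ → ℝ} (h₀ : IsEigenpair L (potential ω p φ) μ₀ u₀ w₀)
    (h₁ : IsEigenpair L (potential ω p φ) μ₁ u₁ w₁) (hu : IsEigenpair L (potential ω p φ) μ u w)
    (hne : μ₀ ≠ μ₁) (h₀a : u₀ (L / 4) = 1) (h₀b : u₀ (-(L / 4)) = 1) (h₁a : u₁ (L / 4) = 1)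
    (h₁b : u₁ (-(L / 4)) = -1) (ho₀ : ∫ x in (0 : ℝ)..L, u x * u₀ x = 0)
    (ho₁ : ∫ x in (0 : ℝ)..L, u x * u₁ x = 0) :
    0 ≤ μ * (∫ x in (0 : ℝ)..L, u x * u x) +
      ((u (L / 4) + u (-(L / 4))) / 2) ^ 2 * (μ₀ * ∫ x in (0 : ℝ)..L, u₀ x * u₀ x) +
      ((u (L / 4) - u (-(L / 4))) / 2) ^ 2 * (μ₁ * ∫ x in (0 : ℝ)..L, u₁ x * u₁ x) := by
  -- The coefficients for which `u - β u₀ - δ u₁` vanishes at both `L / 4` and `-(L / 4)`.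
  set β := (u (L / 4) + u (-(L / 4))) / 2 with hβ
  set δ := (u (L / 4) - u (-(L / 4))) / 2 with hδ
  have ho₀₁ := h₀.orthogonal h₁ hne
  have c := hu.continuous
  have c' := hu.continuous_right
  have c₀ := h₀.continuous
  have c₀' := h₀.continuous_right
  have c₁ := h₁.continuous
  have c₁' := h₁.continuous_right
  have hVc := h.continuous_potential
  set v : ℝ → ℝ := fun x => u x - β * u₀ x - δ * u₁ x with hv
  set v' : ℝ → ℝ := fun x => w x - β * w₀ x - δ * w₁ x with hv'
  have hvd : ∀ x, HasDerivAt v (v' x) x := fun x =>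
    ((hu.solves.1 x).sub ((h₀.solves.1 x).const_mul β)).sub ((h₁.solves.1 x).const_mul δ)
  have hv'd : ∀ x, HasDerivAt v' (potential ω p φ x * v x
      - (μ * u x - β * (μ₀ * u₀ x) - δ * (μ₁ * u₁ x))) x := fun x =>
    (((hu.solves.2 x).sub ((h₀.solves.2 x).const_mul β)).sub
      ((h₁.solves.2 x).const_mul δ)).congr_deriv (by simp only [hv]; ring)
  have hvp : Function.Periodic v L := fun x => by
    simp only [hv, hu.periodic x, h₀.periodic x, h₁.periodic x]
  have hv'p : Function.Periodic v' L := fun x => by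
    simp only [hv', hu.periodic_right x, h₀.periodic_right x, h₁.periodic_right x]
  have hQ := h.quadratic_nonneg hL hvd (by fun_prop) hvp hv'p
    (by simp only [hv, h₀a, h₁a, hβ, hδ]; ring) (by simp only [hv, h₀b, h₁b, hβ, hδ]; ring)
  -- Integration by parts, in the form that `(v v')'` has mean zero, turns the quadratic form into
  -- `∫ v 𝓛v`; expanding leaves the three diagonal terms plus mixed terms, which vanish by
  -- orthogonality.
  have hparts : ∫ x in (0 : ℝ)..L, (v' x * v' x + v x * (potential ω p φ x * v x
      - (μ * u x - β * (μ₀ * u₀ x) - δ * (μ₁ * u₁ x)))) = 0 :=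
    integral_deriv_eq_zero_of_periodic (fun x => (hvd x).mul (hv'd x)) (by fun_prop)
      (fun x => by simp only [Pi.mul_apply, hvp x, hv'p x])
  have hi : ∀ f : ℝ → ℝ, Continuous f → IntervalIntegrable f volume 0 L := fun f hf =>
    hf.intervalIntegrable _ _
  have hsplit : ∫ x in (0 : ℝ)..L, (v' x ^ 2 + potential ω p φ x * v x ^ 2)
      = (∫ x in (0 : ℝ)..L, (v' x * v' x + v x * (potential ω p φ x * v x
          - (μ * u x - β * (μ₀ * u₀ x) - δ * (μ₁ * u₁ x)))))
        + (μ * (∫ x in (0 : ℝ)..L, u x * u x)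
        + β ^ 2 * (μ₀ * ∫ x in (0 : ℝ)..L, u₀ x * u₀ x)
        + δ ^ 2 * (μ₁ * ∫ x in (0 : ℝ)..L, u₁ x * u₁ x)
        + (-(β * (μ + μ₀)) * (∫ x in (0 : ℝ)..L, u x * u₀ x)
        + -(δ * (μ + μ₁)) * (∫ x in (0 : ℝ)..L, u x * u₁ x)
        + β * δ * (μ₀ + μ₁) * ∫ x in (0 : ℝ)..L, u₀ x * u₁ x)) := by
    simp only [← intervalIntegral.integral_const_mul]
    repeat rw [← intervalIntegral.integral_add (hi _ (by fun_prop)) (hi _ (by fun_prop))]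
    congr 1
    funext x
    simp only [hv]
    ring
  rw [hsplit, hparts, ho₀, ho₁, ho₀₁] at hQ
  linarith

/-- Regularity: the second weak derivative `(V - μ) u` has a continuous periodic representative, so
weak eigenfunctions are classical and the analysis of Hill's equation applies to them. -/
lemma mem_eigenspace_iff (h : IsProfile L ω p φ φ') (hL : 0 < L) (μ : ℝ) (u : L2per L) :
    u ∈ eigenspace L ω p φ μ ↔ ∃ U W : ℝ → ℝ, IsEigenpair L (potential ω p φ) μ U W ∧
      u =ᵐ[volume.restrict (Ioc 0 L)] U := by
  have hVc := h.continuous_potential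
  constructor
  · rintro ⟨u₁, u₂, h1, h2, h3⟩
    obtain ⟨U, hU, hUp, huU⟩ := h1.exists_continuous_rep hL
    obtain ⟨W, hW, hWp, huW⟩ := h2.exists_hasDerivAt_rep hL
      (g := fun x => (potential ω p φ x - μ) * U x) (by fun_prop)
      (fun x => by simp only [h.periodic_potential x, hUp x])
      (by
        filter_upwards [h3, huU, Lp.coeFn_smul μ u] with x a1 a2 a3
        rw [a3, Pi.smul_apply, smul_eq_mul, a2] at a1
        rw [potential]
        linear_combination a1)
    obtain ⟨U', hU', hUp', huU'⟩ := h1.exists_hasDerivAt_rep hL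
      (continuous_iff_continuousAt.2 fun x => (hW x).continuousAt) hWp huW
    have hUU' : U' = U := funext (eq_of_ae_eq_of_periodic hL
      (continuous_iff_continuousAt.2 fun x => (hU' x).continuousAt) hU hUp' hUp
      (huU'.symm.trans huU))
    rw [hUU'] at hU'
    exact ⟨U, W, ⟨⟨hU', hW⟩, hUp⟩, huU⟩
  · rintro ⟨U, W, hUW, huU⟩
    have hUc := hUW.continuous
    obtain ⟨u₁, hu₁⟩ := exists_rep_of_continuous (L := L) hUW.continuous_right
    obtain ⟨u₂, hu₂⟩ := exists_rep_of_continuous (L := L)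
      (f := fun x => (potential ω p φ x - μ) * U x) (by fun_prop)
    refine ⟨u₁, u₂, isWeakDeriv_of_hasDerivAt hL hUW.solves.1 hUW.periodic huU hu₁,
      isWeakDeriv_of_hasDerivAt hL hUW.solves.2 hUW.periodic_right hu₁ hu₂, ?_⟩
    filter_upwards [huU, hu₂, Lp.coeFn_smul μ u] with x a1 a2 a3
    rw [a3, Pi.smul_apply, smul_eq_mul, a1, a2, potential]
    ring

/-- The kernel of the linearized operator is spanned by the derivative of the profile. -/
theorem kerL_eq (h : IsProfile L ω p φ φ') (hL : 0 < L) (hp : Even p) (hp0 : 0 < p)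
    {d : L2per L} (hd : d =ᵐ[volume.restrict (Ioc 0 L)] φ') :
    kerL L ω p φ = Submodule.span ℝ {d} := by
  obtain ⟨μ₀, μ₁, u₀, w₀, u₁, w₁, hμ₀, hμ₁, hne, h₀, h₁, h₀a, h₀b, h₁a, h₁b⟩ :=
    h.exists_negative_eigenpairs hL hp hp0
  refine le_antisymm (fun u hu => ?_) ?_
  · obtain ⟨U, W, hUW, huU⟩ := (h.mem_eigenspace_iff hL 0 u).1 hu
    have hI := h.spectral_inequality hL h₀ h₁ hUW hne h₀a h₀b h₁a h₁b
      (hUW.orthogonal h₀ hμ₀.ne') (hUW.orthogonal h₁ hμ₁.ne')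
    have hp₀ := mul_neg_of_neg_of_pos hμ₀
      (h₀.integral_sq_pos hL (x := L / 4) (by rw [h₀a]; exact one_ne_zero))
    have hp₁ := mul_neg_of_neg_of_pos hμ₁
      (h₁.integral_sq_pos hL (x := L / 4) (by rw [h₁a]; exact one_ne_zero))
    -- With `μ = 0` the remaining terms are nonpositive with nonnegative sum, so both coefficients
    -- vanish and `U (L/4) = 0`.
    rw [zero_mul, zero_add] at hI
    have hn₀ := mul_nonpos_of_nonneg_of_nonpos
      (sq_nonneg ((U (L / 4) + U (-(L / 4))) / 2)) hp₀.le
    have hn₁ := mul_nonpos_of_nonneg_of_nonpos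
      (sq_nonneg ((U (L / 4) - U (-(L / 4))) / 2)) hp₁.le
    have hβ := pow_eq_zero_iff two_ne_zero |>.1
      ((mul_eq_zero.1 (le_antisymm hn₀ (by linarith))).resolve_right hp₀.ne)
    have hδ := pow_eq_zero_iff two_ne_zero |>.1
      ((mul_eq_zero.1 (le_antisymm hn₁ (by linarith))).resolve_right hp₁.ne)
    have hU0 : U (L / 4) = 0 := by linarith
    have hs : SolvesHill (potential ω p φ) U W := by simpa using hUW.solves
    obtain ⟨C, hC⟩ := h.exists_bound_potential hL
    have hq := h.second_deriv_quarter_ne hL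
    -- `U` and `φ'` both vanish at `L / 4`, where `φ'' ≠ 0`; matching slopes fixes the multiple.
    have hUφ := fun x => (hs.eq_of_eq (h.solvesHill_deriv.const_mul
      (W (L / 4) / (ω * φ (L / 4) - φ (L / 4) ^ (p + 1)))) hC (x₀ := L / 4)
      (by rw [hU0, h.deriv_quarter hL, mul_zero]) (by field_simp) x).1
    refine Submodule.mem_span_singleton.2
      ⟨W (L / 4) / (ω * φ (L / 4) - φ (L / 4) ^ (p + 1)), Lp.ext ?_⟩
    filter_upwards [huU, hd, Lp.coeFn_smul
      (W (L / 4) / (ω * φ (L / 4) - φ (L / 4) ^ (p + 1))) d] with x a1 a2 a3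
    rw [a3, Pi.smul_apply, smul_eq_mul, a1, a2, hUφ]
  · rw [Submodule.span_singleton_le_iff_mem]
    exact (h.mem_eigenspace_iff hL 0 d).2
      ⟨φ', _, ⟨by simpa using h.solvesHill_deriv, h.periodic'⟩, hd⟩

/-- The linearized operator has exactly two negative eigenvalues, both simple. -/
theorem finrank_ncard_negative (h : IsProfile L ω p φ φ') (hL : 0 < L) (hp : Even p)
    (hp0 : 0 < p) : Module.finrank ℝ (negSubspace L ω p φ) = 2 ∧
      (negEigenvalues L ω p φ).ncard = 2 := by
  obtain ⟨μ₀, μ₁, u₀, w₀, u₁, w₁, hμ₀, hμ₁, hne, h₀, h₁, h₀a, h₀b, h₁a, h₁b⟩ :=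
    h.exists_negative_eigenpairs hL hp hp0
  have hp₀ := h₀.integral_sq_pos hL (x := L / 4) (by rw [h₀a]; exact one_ne_zero)
  have hp₁ := h₁.integral_sq_pos hL (x := L / 4) (by rw [h₁a]; exact one_ne_zero)
  -- For `μ < 0` all three terms of the spectral inequality are nonpositive, so the norm of `U`
  -- vanishes.
  have key : ∀ (μ : ℝ) (U W : ℝ → ℝ), μ < 0 → IsEigenpair L (potential ω p φ) μ U W →
      ∫ x in (0 : ℝ)..L, U x * u₀ x = 0 → ∫ x in (0 : ℝ)..L, U x * u₁ x = 0 → ∀ x, U x = 0 := by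
    intro μ U W hμ hUW ho₀ ho₁
    have hI := h.spectral_inequality hL h₀ h₁ hUW hne h₀a h₀b h₁a h₁b ho₀ ho₁
    have hn₀ := mul_nonpos_of_nonneg_of_nonpos
      (sq_nonneg ((U (L / 4) + U (-(L / 4))) / 2)) (mul_neg_of_neg_of_pos hμ₀ hp₀).le
    have hn₁ := mul_nonpos_of_nonneg_of_nonpos
      (sq_nonneg ((U (L / 4) - U (-(L / 4))) / 2)) (mul_neg_of_neg_of_pos hμ₁ hp₁).le
    refine hUW.eq_zero_of_integral_sq hL (le_antisymm ?_
      (intervalIntegral.integral_nonneg hL.le fun x _ => mul_self_nonneg _))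
    by_contra hpos
    have := mul_neg_of_neg_of_pos hμ (not_le.1 hpos)
    linarith
  -- A Gram–Schmidt step inside one eigenspace. The remainder is orthogonal to `u₀` and `u₁`, so
  -- `key` annihilates it and the eigenvalue is simple.
  have proj : ∀ (μ : ℝ) (U W v w : ℝ → ℝ), IsEigenpair L (potential ω p φ) μ U W →
      IsEigenpair L (potential ω p φ) μ v w → 0 < ∫ x in (0 : ℝ)..L, v x * v x →
      ∫ x in (0 : ℝ)..L, (U x - (∫ x in (0 : ℝ)..L, U x * v x) /
        (∫ x in (0 : ℝ)..L, v x * v x) * v x) * v x = 0 := by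
    intro μ U W v w hU hv hpos
    have c := hU.continuous
    have c' := hv.continuous
    simp only [sub_mul, mul_assoc]
    rw [intervalIntegral.integral_sub
      ((by fun_prop : Continuous fun x => U x * v x).intervalIntegrable _ _)
      (((by fun_prop : Continuous fun x => v x * v x).intervalIntegrable _ _).const_mul _),
      intervalIntegral.integral_const_mul, div_mul_cancel₀ _ hpos.ne', sub_self]
  obtain ⟨e₀, he₀⟩ := exists_rep_of_continuous (L := L) h₀.continuous
  obtain ⟨e₁, he₁⟩ := exists_rep_of_continuous (L := L) h₁.continuous
  have hm₀ : e₀ ∈ eigenspace L ω p φ μ₀ := (h.mem_eigenspace_iff hL _ _).2 ⟨_, _, h₀, he₀⟩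
  have hm₁ : e₁ ∈ eigenspace L ω p φ μ₁ := (h.mem_eigenspace_iff hL _ _).2 ⟨_, _, h₁, he₁⟩
  have hli : LinearIndependent ℝ ![e₀, e₁] := by
    rw [LinearIndependent.pair_iff]
    intro s t hst
    have c₀ := h₀.continuous
    have c₁ := h₁.continuous
    have h2 : ∀ x, s * u₀ x + t * u₁ x = 0 := by
      refine eq_of_ae_eq_of_periodic hL (by fun_prop) continuous_const
        (fun x => by simp only [h₀.periodic x, h₁.periodic x]) (fun _ => rfl) ?_
      have h3 : (s • e₀ + t • e₁ : L2per L) =ᵐ[volume.restrict (Ioc 0 L)] fun _ => 0 := by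
        rw [hst]; exact Lp.coeFn_zero _ _ _
      filter_upwards [h3, he₀, he₁, Lp.coeFn_add (s • e₀) (t • e₁), Lp.coeFn_smul s e₀,
        Lp.coeFn_smul t e₁] with x a1 a2 a3 a4 a5 a6
      rw [a4, Pi.add_apply, a5, a6, Pi.smul_apply, Pi.smul_apply, smul_eq_mul, smul_eq_mul,
        a2, a3] at a1
      exact a1
    have h3 := h2 (L / 4)
    have h4 := h2 (-(L / 4))
    rw [h₀a, h₁a] at h3
    rw [h₀b, h₁b] at h4
    exact ⟨by linarith, by linarith⟩
  have he₀0 : e₀ ≠ 0 := hli.ne_zero 0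
  have he₁0 : e₁ ≠ 0 := hli.ne_zero 1
  have hcls : ∀ (c : ℝ) (u e : L2per L) (U v : ℝ → ℝ), u =ᵐ[volume.restrict (Ioc 0 L)] U →
      e =ᵐ[volume.restrict (Ioc 0 L)] v → (∀ x, U x - c * v x = 0) → u ∈ Submodule.span ℝ {e} := by
    intro c u e U v hu he hx
    refine Submodule.mem_span_singleton.2 ⟨c, Lp.ext ?_⟩
    filter_upwards [hu, he, Lp.coeFn_smul c e] with x a1 a2 a3
    rw [a3, Pi.smul_apply, smul_eq_mul, a1, a2]
    linarith [hx x]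
  have hE₀ : eigenspace L ω p φ μ₀ = Submodule.span ℝ {e₀} := by
    refine le_antisymm (fun u hu => ?_) ((Submodule.span_singleton_le_iff_mem _ _).2 hm₀)
    obtain ⟨U, W, hUW, huU⟩ := (h.mem_eigenspace_iff hL _ u).1 hu
    have hs := hUW.sub_const_mul h₀
      ((∫ x in (0 : ℝ)..L, U x * u₀ x) / (∫ x in (0 : ℝ)..L, u₀ x * u₀ x))
    exact hcls _ u e₀ U u₀ huU he₀
      (key μ₀ _ _ hμ₀ hs (proj μ₀ U W u₀ w₀ hUW h₀ hp₀) (hs.orthogonal h₁ hne))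
  have hE₁ : eigenspace L ω p φ μ₁ = Submodule.span ℝ {e₁} := by
    refine le_antisymm (fun u hu => ?_) ((Submodule.span_singleton_le_iff_mem _ _).2 hm₁)
    obtain ⟨U, W, hUW, huU⟩ := (h.mem_eigenspace_iff hL _ u).1 hu
    have hs := hUW.sub_const_mul h₁
      ((∫ x in (0 : ℝ)..L, U x * u₁ x) / (∫ x in (0 : ℝ)..L, u₁ x * u₁ x))
    exact hcls _ u e₁ U u₁ huU he₁
      (key μ₁ _ _ hμ₁ hs (hs.orthogonal h₀ hne.symm) (proj μ₁ U W u₁ w₁ hUW h₁ hp₁))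
  have hneg : negEigenvalues L ω p φ = {μ₀, μ₁} := by
    ext μ
    constructor
    · rintro ⟨hμ, hbot⟩
      by_contra hnot
      simp only [mem_insert_iff, mem_singleton_iff, not_or] at hnot
      obtain ⟨u, hu, hu0⟩ := Submodule.exists_mem_ne_zero_of_ne_bot hbot
      obtain ⟨U, W, hUW, huU⟩ := (h.mem_eigenspace_iff hL _ u).1 hu
      refine hu0 (Lp.ext ?_)
      filter_upwards [huU, Lp.coeFn_zero ℝ 2 (volume.restrict (Ioc (0 : ℝ) L))] with x a1 a2
      rw [a1, a2, key μ U W hμ hUW (hUW.orthogonal h₀ hnot.1) (hUW.orthogonal h₁ hnot.2) x,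
        Pi.zero_apply]
    · rintro (rfl | rfl)
      · exact ⟨hμ₀, (Submodule.ne_bot_iff _).2 ⟨e₀, hm₀, he₀0⟩⟩
      · exact ⟨hμ₁, (Submodule.ne_bot_iff _).2 ⟨e₁, hm₁, he₁0⟩⟩
  refine ⟨?_, by rw [hneg, ncard_pair hne]⟩
  have hspan : negSubspace L ω p φ = Submodule.span ℝ (range ![e₀, e₁]) := by
    rw [negSubspace, hneg, iSup_pair, hE₀, hE₁, ← Submodule.span_union, Matrix.range_cons,
      Matrix.range_cons, Matrix.range_empty, union_empty]
  rw [hspan, finrank_span_eq_card hli, Fintype.card_fin]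

/-- Bootstrapping on `φ` and `φ'` together, since the equation expresses `φ''` polynomially in `φ`.
-/
lemma contDiff (h : IsProfile L ω p φ φ') : ContDiff ℝ (⊤ : ℕ∞) φ := by
  have key : ∀ n : ℕ, ContDiff ℝ n φ ∧ ContDiff ℝ n φ' := by
    intro n
    induction n with
    | zero => exact ⟨contDiff_zero.2 h.continuous, contDiff_zero.2 h.continuous'⟩
    | succ n ih =>
      have d1 : deriv φ = φ' := funext fun x => (h.hasDerivAt x).deriv
      have d2 : deriv φ' = fun x => ω * φ x - φ x ^ (p + 1) :=
        funext fun x => (h.hasDerivAt' x).deriv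
      push_cast
      refine ⟨contDiff_succ_iff_deriv.2 ⟨fun x => (h.hasDerivAt x).differentiableAt, by simp, ?_⟩,
        contDiff_succ_iff_deriv.2 ⟨fun x => (h.hasDerivAt' x).differentiableAt, by simp, ?_⟩⟩
      · rw [d1]; exact ih.2
      · rw [d2]; exact (contDiff_const.mul ih.1).sub (ih.1.pow _)
  exact contDiff_infty.2 fun n => (key n).1

end IsProfile

end OddWave
end

theorem lemma4p3 (L ω γ : ℝ) (p : ℕ) (hL : 0 < L) (hω : 0 < ω) (hγ : 0 < γ)
    (hp : Even p) (hp0 : 0 < p)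
    (ψ : OddWave.L2per L) (hψ : ψ ∈ OddWave.Z L p γ)
    (hmin : IsMinOn (OddWave.B L ω) (OddWave.Z L p γ) ψ) :
    ∃ (k : ℝ) (φ : ℝ → ℝ), 0 < k ∧
      (∀ᵐ x ∂(volume.restrict (Ioc (0 : ℝ) L)), φ x = k * ψ x) ∧
      ContDiff ℝ (⊤ : ℕ∞) φ ∧ Function.Periodic φ L ∧ Function.Odd φ ∧
      (∀ x, - deriv (deriv φ) x + ω * φ x - φ x ^ (p + 1) = 0) ∧
      (∃ dφ : OddWave.L2per L,
        (∀ᵐ x ∂(volume.restrict (Ioc (0 : ℝ) L)), dφ x = deriv φ x) ∧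
        OddWave.kerL L ω p φ = Submodule.span ℝ {dφ}) ∧
      Module.finrank ℝ (OddWave.negSubspace L ω p φ) = 2 ∧
      (OddWave.negEigenvalues L ω p φ).ncard = 2 := by
  obtain ⟨Ψ, Ψ', hψΨ, hΨp, hΨo, hΨ, -, hΨ'⟩ := OddWave.exists_profile hL hω hγ hp hψ hmin
  have hc : 0 < 2 * OddWave.B L ω ψ / γ := by
    have := OddWave.B_pos hω hγ hψ
    positivity
  set c := 2 * OddWave.B L ω ψ / γ with hcdef
  -- Chosen so that `k^p = c`: then `k c Ψ^(p+1) = (k Ψ)^(p+1)`, and the multiplier disappears.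
  set k : ℝ := c ^ ((p : ℝ)⁻¹) with hk
  have hk0 : 0 < k := Real.rpow_pos_of_pos hc _
  have hkp : k ^ p = c := Real.rpow_inv_natCast_pow hc.le hp0.ne'
  have h : OddWave.IsProfile L ω p (fun x => k * Ψ x) (fun x => k * Ψ' x) :=
    { periodic := fun x => by simp only [hΨp x]
      odd := fun x => by simp only [hΨo x, mul_neg]
      hasDerivAt := fun x => (hΨ x).const_mul k
      hasDerivAt' := fun x => ((hΨ' x).const_mul k).congr_deriv (by
        rw [mul_pow, pow_succ k p, hkp]; ring)
      ne_zero := fun x hx => mul_ne_zero hk0.ne'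
        (OddWave.minimizer_ne_zero hL hω hγ hp hψ hmin hψΨ hΨp hΨo hΨ hΨ' hx) }
  have hd : deriv (fun x => k * Ψ x) = fun x => k * Ψ' x :=
    funext fun x => (h.hasDerivAt x).deriv
  obtain ⟨d, hdφ⟩ := OddWave.exists_rep_of_continuous (L := L) h.continuous'
  obtain ⟨hfin, hcard⟩ := h.finrank_ncard_negative hL hp hp0
  refine ⟨k, fun x => k * Ψ x, hk0, ?_, h.contDiff, h.periodic, h.odd, fun x => ?_,
    ⟨d, ?_, h.kerL_eq hL hp hp0 hdφ⟩, hfin, hcard⟩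
  · filter_upwards [hψΨ] with x hx
    rw [hx]
  · rw [hd, (h.hasDerivAt' x).deriv]
    ring
  · rw [hd]; exact hdφ
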